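/- Let $n,p,m\in\mathbb N$ and consider the system with multiplicative noise $$x_{k+1}=A(w_k)x_k+B(w_k)u_k,\qquad A(w)=A_0+\sum_{i=1}^m w^{(i)}A_i,\quad B(w)=B_0+\sum_{i=1}^m w^{(i)}B_i,$$ with state $x_k\in\mathbb R^n$, input $u_k\in\mathbb R^p$ and i.i.d. disturbances $w_k\in\mathbb R^m$ with a square integrable distribution $\mathbb P_w$ of known mean $\mu$. Let $Q\succ0$, $R\succ0$. Let $\hat\Sigma$ be a random positive semidefinite $m\times m$ matrix on a probability space $(\Omega,\mathcal F,\mathbb P)$ (an estimate of the covariance computed from data independent of the future disturbances), let $r_\Sigma>0$, $\beta\in[0,1]$, and let $$\mathcal A_\Sigma=\{\nu:\ \nu\text{ a square integrable distribution on }\mathbb R^m,\ \mathbb E_\nu[v]=\mu,\ \mathbb E_\nu[(v-\mu)(v-\mu)^\top]\preceq r_\Sigma\hat\Sigma\}$$ be the resulting random ambiguity set. Assume $\mathbb P(\mathbb P_w\in\mathcal A_\Sigma)\ge1-\beta$. The system is called DR mean-square stabilizable if there are a matrix $K$ and $\bar P\succ0$ with $$\bar P-\max_{\nu\in\mathcal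 A_\Sigma}\mathbb E_\nu\big[(A(v)+B(v)K)^\top\bar P(A(v)+B(v)K)\big]\succ0$$ (the maximum being taken in the Loewner order). A matrix $K$ is mean-square stabilizing for the distribution $\nu$ if $\mathbb E[x_k^\top x_k]\to0$ for $x_{k+1}=(A(w_k)+B(w_k)K)x_k$, with $w_k$ i.i.d. with distribution $\nu$, from every initial state $x_0$. The distributionally robust LQR problem from the initial state $x_0$ is to minimize, over all input sequences in which $u_k$ is a measurable function of $w_0,\dots,w_{k-1}$ (in particular over all measurable feedback laws in the states $x_0,\dots,x_k$), the worst-case cost $$\sup_{\nu\in\mathcal A_\Sigma}\mathbb E_{\nu^{\infty}}\Big[\sum_{k=0}^\infty x_k^\top Qx_k+u_k^\top Ru_k\Big]\in[0,\infty].$$ Let $\mathbf A_0=[A_0^\top\ A_1^\top\cdots A_m^\top]^\top$, $\mathbf B_0=[B_0^\top\ B_1^\top\cdots B_m^\top]^\top$, $\bar\Sigma=\begin{bmatrix}1&\mu^\top\\ \mu&r_\Sigma\hat\Sigma+\mu\mu^\top\end{bmatrix}$, and $$F(P)=\mathbf A_0^\top(\bar\Sigma\otimes P)\mathbf A_0,\quad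 G(P)=\mathbf B_0^\top(\bar\Sigma\otimes P)\mathbf B_0,\quad H(P)=\mathbf B_0^\top(\bar\Sigma\otimes P)\mathbf A_0 .$$ Then for every realization of $\hat\Sigma$ for which the system is DR mean-square stabilizable: 1. the Riccati equation $P=Q+F(P)-H(P)^\top(R+G(P))^{-1}H(P)$ has exactly one solution $P_\infty\succeq0$; 2. $P_\infty$ is the unique solution of the semidefinite program $$\min_P\ -\operatorname{tr}P\quad\text{s.t.}\quad\begin{bmatrix}Q-P+F(P)&H(P)^\top\\H(P)&R+G(P)\end{bmatrix}\succeq0,\quad P\succeq0;$$ 3. the linear controller $u_k=K_\infty x_k$ with $K_\infty=-(R+G(P_\infty))^{-1}H(P_\infty)$ solves the distributionally robust LQR problem from every initial state $x_0$, with optimal value $x_0^\top P_\infty x_0$, and $K_\infty$ is the only gain with this optimality property; 4. $K_\infty$ is mean-square stabilizing for every $\nu\in\mathcal A_\Sigma$. Moreover, with probability at least $1-\beta$, either the realization of $\hat\Sigma$ is one for which the system is not DR mean-square stabilizable, or $K_\infty$ is mean-square stabilizing for the true distribution $\mathbb P_w$. In particular, if the system is DR mean-square stabilizable for almost every realization,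 then $K_\infty$ is mean-square stabilizing for the true system with probability at least $1-\beta$. -/

import Mathlib

open MeasureTheory Matrix Filter Topology
open scoped ENNReal Kronecker

noncomputable section

namespace DRLQR

/-- The matrices `A₀, A₁, …, A_m` and `B₀, B₁, …, B_m` of the linear system with state- and
input-multiplicative noise `x_{k+1} = A(w_k) x_k + B(w_k) u_k`
(state in `ℝⁿ`, input in `ℝᵖ`, disturbance in `ℝᵐ`). -/
structure NoisySystem (n p m : ℕ) where
  A0 : Matrix (Fin n) (Fin n) ℝ
  A : Fin m → Matrix (Fin n) (Fin n) ℝ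
  B0 : Matrix (Fin n) (Fin p) ℝ
  B : Fin m → Matrix (Fin n) (Fin p) ℝ

variable {n p m : ℕ}

/-- `A(w) = A₀ + ∑ᵢ wᵢ Aᵢ`. -/
def NoisySystem.stateMatrix (S : NoisySystem n p m) (w : Fin m → ℝ) :
    Matrix (Fin n) (Fin n) ℝ :=
  S.A0 + ∑ i, w i • S.A i

/-- `B(w) = B₀ + ∑ᵢ wᵢ Bᵢ`. -/
def NoisySystem.inputMatrix (S : NoisySystem n p m) (w : Fin m → ℝ) :
    Matrix (Fin n) (Fin p) ℝ :=
  S.B0 + ∑ i, w i • S.B i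

/-- The closed-loop matrix `A(w) + B(w) K`. -/
def NoisySystem.closedLoopMatrix (S : NoisySystem n p m) (K : Matrix (Fin p) (Fin n) ℝ)
    (w : Fin m → ℝ) : Matrix (Fin n) (Fin n) ℝ :=
  S.stateMatrix w + S.inputMatrix w * K

/-! ### Distributions of the disturbance -/

/-- The distribution `ν` on `ℝᵐ` is square integrable. -/
def SquareIntegrable (ν : ProbabilityMeasure (Fin m → ℝ)) : Prop :=
  ∀ i, MemLp (fun v : Fin m → ℝ => v i) 2 (ν : Measure (Fin m → ℝ))

/-- The mean `E_ν[v]`. -/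
def mean (ν : ProbabilityMeasure (Fin m → ℝ)) : Fin m → ℝ :=
  fun i => ∫ v, v i ∂(ν : Measure (Fin m → ℝ))

/-- The matrix `E_ν[(v - μ)(v - μ)ᵀ]`. -/
def covAbout (μ : Fin m → ℝ) (ν : ProbabilityMeasure (Fin m → ℝ)) :
    Matrix (Fin m) (Fin m) ℝ :=
  Matrix.of fun i j => ∫ v, (v i - μ i) * (v j - μ j) ∂(ν : Measure (Fin m → ℝ))

/-- The ambiguity set of all square integrable distributions `ν` on `ℝᵐ` with
`E_ν[(v - μ)(v - μ)ᵀ] ≼ C` and `E_ν[v] = μ`. -/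
def ambiguitySet (μ : Fin m → ℝ) (C : Matrix (Fin m) (Fin m) ℝ) :
    Set (ProbabilityMeasure (Fin m → ℝ)) :=
  {ν | SquareIntegrable ν ∧ (C - covAbout μ ν).PosSemidef ∧ mean ν = μ}

/-- The law of an i.i.d. sequence `w₀, w₁, …` with common distribution `ν`. -/
def iidLaw (ν : ProbabilityMeasure (Fin m → ℝ)) : Measure (ℕ → Fin m → ℝ) :=
  Measure.infinitePi fun _ => (ν : Measure (Fin m → ℝ))

/-! ### Stability -/

/-- The state at time `k` of the closed loop `x_{k+1} = (A(w_k) + B(w_k) K) x_k` started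
at `x₀`. -/
def closedLoop (S : NoisySystem n p m) (K : Matrix (Fin p) (Fin n) ℝ) (x₀ : Fin n → ℝ)
    (w : ℕ → Fin m → ℝ) : ℕ → Fin n → ℝ
  | 0 => x₀
  | k + 1 => S.closedLoopMatrix K (w k) *ᵥ closedLoop S K x₀ w k

/-- The gain `K` is mean-square stabilizing when the disturbances are i.i.d. with
distribution `ν`: `E[x_kᵀ x_k] → 0` along the closed loop, from every initial state. -/
def MeanSquareStabilizing (S : NoisySystem n p m) (ν : ProbabilityMeasure (Fin m → ℝ))
    (K : Matrix (Fin p) (Fin n) ℝ) : Prop :=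
  ∀ x₀ : Fin n → ℝ,
    Tendsto (fun k => ∫⁻ w, ENNReal.ofReal (closedLoop S K x₀ w k ⬝ᵥ closedLoop S K x₀ w k)
      ∂(iidLaw ν)) atTop (𝓝 0)

/-- The matrix `E_ν[(A(v) + B(v) K)ᵀ P (A(v) + B(v) K)]`. -/
def lyapunovExpectation (S : NoisySystem n p m) (K : Matrix (Fin p) (Fin n) ℝ)
    (P : Matrix (Fin n) (Fin n) ℝ) (ν : ProbabilityMeasure (Fin m → ℝ)) :
    Matrix (Fin n) (Fin n) ℝ :=
  Matrix.of fun i j =>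
    ∫ v, ((S.closedLoopMatrix K v)ᵀ * P * S.closedLoopMatrix K v) i j
      ∂(ν : Measure (Fin m → ℝ))

/-- Distributionally robust mean-square stabilizability: there are a gain `K` and `P ≻ 0` with
`P - max_{ν ∈ 𝒜} E_ν[(A(v) + B(v) K)ᵀ P (A(v) + B(v) K)] ≻ 0`, the maximum `M` being the greatest
element for the Loewner order. -/
def DRStabilizable (S : NoisySystem n p m) (𝒜 : Set (ProbabilityMeasure (Fin m → ℝ))) : Prop :=
  ∃ (K : Matrix (Fin p) (Fin n) ℝ) (P M : Matrix (Fin n) (Fin n) ℝ), P.PosDef ∧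
    (∃ ν ∈ 𝒜, lyapunovExpectation S K P ν = M) ∧
    (∀ ν ∈ 𝒜, (M - lyapunovExpectation S K P ν).PosSemidef) ∧
    (P - M).PosDef

/-! ### The distributionally robust LQR problem -/

/-- The state at time `k` of `x_{k+1} = A(w_k) x_k + B(w_k) u_k` started at `x₀`. The input
process `u` is a function of time and of the disturbance sequence. -/
def stateTraj (S : NoisySystem n p m) (x₀ : Fin n → ℝ)
    (u : ℕ → (ℕ → Fin m → ℝ) → Fin p → ℝ) (w : ℕ → Fin m → ℝ) : ℕ → Fin n → ℝ
  | 0 => x₀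
  | k + 1 => S.stateMatrix (w k) *ᵥ stateTraj S x₀ u w k + S.inputMatrix (w k) *ᵥ u k w

/-- The input process `u` is admissible when `u_k` is a Borel function of the past
disturbances `w₀, …, w_{k-1}`. As the initial state is fixed, every (Borel) feedback law in the
states `x₀, …, x_k` gives such a process. -/
def Admissible (u : ℕ → (ℕ → Fin m → ℝ) → Fin p → ℝ) : Prop :=
  ∀ k, ∃ g : (Fin k → Fin m → ℝ) → Fin p → ℝ,
    Measurable g ∧ ∀ w, u k w = g fun i => w i

/-- The expected cost `E[∑_{k ≥ 0} x_kᵀ Q x_k + u_kᵀ R u_k]`, in `[0, ∞]`, when the disturbances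
are i.i.d. with distribution `ν`. -/
def expectedCost (S : NoisySystem n p m) (Q : Matrix (Fin n) (Fin n) ℝ)
    (R : Matrix (Fin p) (Fin p) ℝ) (x₀ : Fin n → ℝ)
    (u : ℕ → (ℕ → Fin m → ℝ) → Fin p → ℝ) (ν : ProbabilityMeasure (Fin m → ℝ)) : ℝ≥0∞ :=
  ∫⁻ w, ∑' k, ENNReal.ofReal
    (stateTraj S x₀ u w k ⬝ᵥ Q *ᵥ stateTraj S x₀ u w k + u k w ⬝ᵥ R *ᵥ u k w) ∂(iidLaw ν)

/-- The worst-case expected cost over the ambiguity set `𝒜`. -/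
def worstCaseCost (S : NoisySystem n p m) (Q : Matrix (Fin n) (Fin n) ℝ)
    (R : Matrix (Fin p) (Fin p) ℝ) (𝒜 : Set (ProbabilityMeasure (Fin m → ℝ)))
    (x₀ : Fin n → ℝ) (u : ℕ → (ℕ → Fin m → ℝ) → Fin p → ℝ) : ℝ≥0∞ :=
  ⨆ ν ∈ 𝒜, expectedCost S Q R x₀ u ν

/-- The input process generated by the linear controller `u_k = K x_k`. -/
def feedbackInput (S : NoisySystem n p m) (K : Matrix (Fin p) (Fin n) ℝ) (x₀ : Fin n → ℝ) :
    ℕ → (ℕ → Fin m → ℝ) → Fin p → ℝ :=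
  fun k w => K *ᵥ closedLoop S K x₀ w k

theorem stateTraj_feedbackInput (S : NoisySystem n p m) (K : Matrix (Fin p) (Fin n) ℝ)
    (x₀ : Fin n → ℝ) (w : ℕ → Fin m → ℝ) (k : ℕ) :
    stateTraj S x₀ (feedbackInput S K x₀) w k = closedLoop S K x₀ w k := by
  induction k with
  | zero => rfl
  | succ k ih =>
    simp only [stateTraj, closedLoop, ih, feedbackInput, NoisySystem.closedLoopMatrix,
      Matrix.add_mulVec, Matrix.mulVec_mulVec]

/-- The linear controller `u_k = K x_k` solves the distributionally robust LQR problem: from every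
initial state it minimizes the worst-case expected cost among all admissible input processes. -/
def IsOptimalGain (S : NoisySystem n p m) (Q : Matrix (Fin n) (Fin n) ℝ)
    (R : Matrix (Fin p) (Fin p) ℝ) (𝒜 : Set (ProbabilityMeasure (Fin m → ℝ)))
    (K : Matrix (Fin p) (Fin n) ℝ) : Prop :=
  ∀ x₀ : Fin n → ℝ, Admissible (feedbackInput S K x₀) ∧
    ∀ u, Admissible u →
      worstCaseCost S Q R 𝒜 x₀ (feedbackInput S K x₀) ≤ worstCaseCost S Q R 𝒜 x₀ u

/-! ### The nominal solution for mean `μ` and covariance `C` -/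

/-- The augmented second moment matrix `[1, μᵀ; μ, C + μ μᵀ]`. -/
def augmentedMoment (μ : Fin m → ℝ) (C : Matrix (Fin m) (Fin m) ℝ) :
    Matrix (Unit ⊕ Fin m) (Unit ⊕ Fin m) ℝ :=
  Matrix.fromBlocks 1 (Matrix.replicateRow Unit μ) (Matrix.replicateCol Unit μ)
    (C + Matrix.vecMulVec μ μ)

/-- `A₀, A₁, …, A_m` stacked on top of each other. -/
def NoisySystem.stackedA (S : NoisySystem n p m) :
    Matrix ((Unit ⊕ Fin m) × Fin n) (Fin n) ℝ :=
  Matrix.of fun ia b => (Sum.elim (fun _ => S.A0) S.A ia.1) ia.2 b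

/-- `B₀, B₁, …, B_m` stacked on top of each other. -/
def NoisySystem.stackedB (S : NoisySystem n p m) :
    Matrix ((Unit ⊕ Fin m) × Fin n) (Fin p) ℝ :=
  Matrix.of fun ia b => (Sum.elim (fun _ => S.B0) S.B ia.1) ia.2 b

def opF (S : NoisySystem n p m) (μ : Fin m → ℝ) (C : Matrix (Fin m) (Fin m) ℝ)
    (P : Matrix (Fin n) (Fin n) ℝ) : Matrix (Fin n) (Fin n) ℝ :=
  S.stackedAᵀ * (augmentedMoment μ C ⊗ₖ P) * S.stackedA

def opG (S : NoisySystem n p m) (μ : Fin m → ℝ) (C : Matrix (Fin m) (Fin m) ℝ)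
    (P : Matrix (Fin n) (Fin n) ℝ) : Matrix (Fin p) (Fin p) ℝ :=
  S.stackedBᵀ * (augmentedMoment μ C ⊗ₖ P) * S.stackedB

def opH (S : NoisySystem n p m) (μ : Fin m → ℝ) (C : Matrix (Fin m) (Fin m) ℝ)
    (P : Matrix (Fin n) (Fin n) ℝ) : Matrix (Fin p) (Fin n) ℝ :=
  S.stackedBᵀ * (augmentedMoment μ C ⊗ₖ P) * S.stackedA

/-- `P ≽ 0` solves the Riccati equation `P = Q + F(P) - H(P)ᵀ (R + G(P))⁻¹ H(P)`. -/
def IsRiccatiSolution (S : NoisySystem n p m) (Q : Matrix (Fin n) (Fin n) ℝ)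
    (R : Matrix (Fin p) (Fin p) ℝ) (μ : Fin m → ℝ) (C : Matrix (Fin m) (Fin m) ℝ)
    (P : Matrix (Fin n) (Fin n) ℝ) : Prop :=
  P.PosSemidef ∧
    P = Q + opF S μ C P - (opH S μ C P)ᵀ * (R + opG S μ C P)⁻¹ * opH S μ C P

/-- The gain `K = -(R + G(P))⁻¹ H(P)`. -/
def riccatiGain (S : NoisySystem n p m) (R : Matrix (Fin p) (Fin p) ℝ) (μ : Fin m → ℝ)
    (C : Matrix (Fin m) (Fin m) ℝ) (P : Matrix (Fin n) (Fin n) ℝ) : Matrix (Fin p) (Fin n) ℝ :=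
  -((R + opG S μ C P)⁻¹ * opH S μ C P)

/-- The constraints `[Q - P + F(P), H(P)ᵀ; H(P), R + G(P)] ≽ 0` and `P ≽ 0` of the semidefinite
program. -/
def SDPFeasible (S : NoisySystem n p m) (Q : Matrix (Fin n) (Fin n) ℝ)
    (R : Matrix (Fin p) (Fin p) ℝ) (μ : Fin m → ℝ) (C : Matrix (Fin m) (Fin m) ℝ)
    (P : Matrix (Fin n) (Fin n) ℝ) : Prop :=
  (Matrix.fromBlocks (Q - P + opF S μ C P) (opH S μ C P)ᵀ
    (opH S μ C P) (R + opG S μ C P)).PosSemidef ∧ P.PosSemidef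

/-- `P` minimizes `-tr P` under the constraints of the semidefinite program. -/
def IsSDPSolution (S : NoisySystem n p m) (Q : Matrix (Fin n) (Fin n) ℝ)
    (R : Matrix (Fin p) (Fin p) ℝ) (μ : Fin m → ℝ) (C : Matrix (Fin m) (Fin m) ℝ)
    (P : Matrix (Fin n) (Fin n) ℝ) : Prop :=
  SDPFeasible S Q R μ C P ∧
    ∀ P', SDPFeasible S Q R μ C P' → -P.trace ≤ -P'.trace

end DRLQR

end

noncomputable section

namespace DRLQR

section Loewner

open scoped MatrixOrder

/-! ### The Loewner order on real matrices -/

/-! For a fixed state and input the next state is linear in `(1, w)`, so an expected quadratic cost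
depends on `ν` only through the second moment matrix of `(1, w)`, and monotonically so. Every `ν` in
the ambiguity set has second moment at most `augmentedMoment μ C` with `C = r • Shat ω`
(`secondMoment_le`), and a finitely supported member attains it
(`exists_mem_ambiguitySet_secondMoment_eq`). The robust problem is thus an ordinary
multiplicative-noise LQR problem with nominal moments: upper bounds hold for all `ν`, lower bounds
come from the attaining one.

For the nominal problem, a Schur complement turns the semidefinite constraint into `0 ≼ P ≼ Ric(P)`,
where `Ric` is the minimum over gains of monotone affine operators. A Lyapunov certificate makes
this set compact, and a point of maximal trace must be a fixed point of `Ric`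
(`exists_riccatiSolution`). Conversely, since `Q ≻ 0`, a Riccati solution certifies its own closed
loop, hence dominates every feasible matrix. This gives uniqueness for both the equation and the
program.

Optimality is a telescoping argument with value function `xᵀ P x`. Completing the square, the
one-step cost exceeds the value by a square in `u - K x`. Under the attaining distribution this is
an identity, and finite cost forces the terminal energy to vanish. Keeping the square at time `0`
singles out the gain. Finite cost also yields mean-square stability, and the probabilistic claims
are inclusions of events. -/

theorem posSemidef_iff_real {k : Type*} [Fintype k] {M : Matrix k k ℝ} :
    M.PosSemidef ↔ Mᵀ = M ∧ ∀ x : k → ℝ, 0 ≤ x ⬝ᵥ M *ᵥ x := by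
  rw [posSemidef_iff_dotProduct_mulVec, IsHermitian, conjTranspose_eq_transpose_of_trivial]
  simp

theorem PosSemidef.quad_nonneg {k : Type*} [Fintype k] {M : Matrix k k ℝ} (h : M.PosSemidef)
    (x : k → ℝ) : 0 ≤ x ⬝ᵥ M *ᵥ x :=
  (posSemidef_iff_real.1 h).2 x

theorem PosSemidef.transpose_eq {k : Type*} {M : Matrix k k ℝ} (h : M.PosSemidef) : Mᵀ = M := by
  simpa [IsHermitian, conjTranspose_eq_transpose_of_trivial] using h.1

theorem PosDef.quad_pos {k : Type*} [Fintype k] {M : Matrix k k ℝ} (h : M.PosDef)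
    {x : k → ℝ} (hx : x ≠ 0) : 0 < x ⬝ᵥ M *ᵥ x := by
  simpa using h.dotProduct_mulVec_pos hx

theorem quad_le_quad {k : Type*} [Fintype k] {M N : Matrix k k ℝ} (h : M ≤ N) (x : k → ℝ) :
    x ⬝ᵥ M *ᵥ x ≤ x ⬝ᵥ N *ᵥ x := by
  have := PosSemidef.quad_nonneg (le_iff.1 h) x
  rw [sub_mulVec, dotProduct_sub] at this
  linarith

theorem transpose_mul_mul_le {k l : Type*} [Fintype k] [Fintype l] {M N : Matrix k k ℝ}
    (h : M ≤ N) (B : Matrix k l ℝ) : Bᵀ * M * B ≤ Bᵀ * N * B := by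
  rw [le_iff, ← Matrix.sub_mul, ← Matrix.mul_sub, ← conjTranspose_eq_transpose_of_trivial]
  exact (le_iff.1 h).conjTranspose_mul_mul_same B

theorem transpose_mul_mul_nonneg {k l : Type*} [Fintype k] [Fintype l] {M : Matrix k k ℝ}
    (h : M.PosSemidef) (B : Matrix k l ℝ) : (Bᵀ * M * B).PosSemidef := by
  rw [← conjTranspose_eq_transpose_of_trivial]
  exact h.conjTranspose_mul_mul_same B

theorem continuous_quad {k : Type*} [Fintype k] (M : Matrix k k ℝ) :
    Continuous fun x : k → ℝ => x ⬝ᵥ M *ᵥ x := by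
  fun_prop

/-- Every symmetric matrix is dominated by a multiple of a given positive definite matrix. -/
theorem exists_le_smul_of_posDef {k : Type*} [Fintype k] {W X : Matrix k k ℝ} (hW : W.PosDef)
    (hX : Xᵀ = X) : ∃ c : ℝ, 0 < c ∧ X ≤ c • W := by
  have hcomp : IsCompact (Metric.sphere (0 : k → ℝ) 1) := isCompact_sphere _ _
  have hne : ∀ x ∈ Metric.sphere (0 : k → ℝ) 1, x ≠ 0 := by
    rintro x hx rfl
    simp at hx
  -- The generalized Rayleigh quotient is bounded on the compact unit sphere; degree-two homogeneity
  -- then extends the bound to all vectors.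
  obtain ⟨c, hc⟩ := hcomp.exists_bound_of_continuousOn
    (f := fun x : k → ℝ => (x ⬝ᵥ X *ᵥ x) / (x ⬝ᵥ W *ᵥ x))
    (ContinuousOn.div (continuous_quad X).continuousOn (continuous_quad W).continuousOn
      fun x hx => (PosDef.quad_pos hW (hne x hx)).ne')
  -- The bound `c` need not be positive (for instance if `X = 0`), hence the maximum with `1`.
  refine ⟨max c 1, by positivity, ?_⟩
  rw [le_iff, posSemidef_iff_real]
  refine ⟨by rw [transpose_sub, transpose_smul, hX, PosSemidef.transpose_eq hW.posSemidef], ?_⟩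
  intro x
  rw [sub_mulVec, dotProduct_sub, sub_nonneg, smul_mulVec, dotProduct_smul, smul_eq_mul]
  rcases eq_or_ne x 0 with rfl | hx
  · simp
  have hnx : 0 < ‖x‖ := norm_pos_iff.2 hx
  set y : k → ℝ := ‖x‖⁻¹ • x with hy
  have hyS : y ∈ Metric.sphere (0 : k → ℝ) 1 := by
    rw [mem_sphere_zero_iff_norm, hy, norm_smul, norm_inv, norm_norm, inv_mul_cancel₀ hnx.ne']
  have hxy : x = ‖x‖ • y := by rw [hy, smul_smul, mul_inv_cancel₀ hnx.ne', one_smul]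
  have hWy := PosDef.quad_pos hW (hne y hyS)
  have h1 : y ⬝ᵥ X *ᵥ y ≤ max c 1 * (y ⬝ᵥ W *ᵥ y) := by
    rw [← div_le_iff₀ hWy]
    exact ((le_abs_self _).trans (hc y hyS)).trans (le_max_left _ _)
  have hs : ∀ M : Matrix k k ℝ, x ⬝ᵥ M *ᵥ x = ‖x‖ ^ 2 * (y ⬝ᵥ M *ᵥ y) := by
    intro M
    conv_lhs => rw [hxy]
    rw [mulVec_smul, smul_dotProduct, dotProduct_smul, smul_eq_mul, smul_eq_mul]
    ring
  rw [hs X, hs W, mul_left_comm]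
  exact mul_le_mul_of_nonneg_left h1 (by positivity)

/-- A strict decrease is a contraction rate: `W ≼ (c + 1)(W - L)` rearranges to `L ≼ (1 - 1/(c + 1))
W`. -/
theorem exists_le_smul_of_posDef_sub {k : Type*} [Fintype k] {W L : Matrix k k ℝ} (hW : W.PosDef)
    (h : (W - L).PosDef) : ∃ ρ : ℝ, 0 ≤ ρ ∧ ρ < 1 ∧ L ≤ ρ • W := by
  obtain ⟨c, hc, hle⟩ := exists_le_smul_of_posDef h (PosSemidef.transpose_eq hW.posSemidef)
  have hc1 : (0 : ℝ) < c + 1 := by positivity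
  have hle' : W ≤ (c + 1) • (W - L) := by
    rw [add_smul, one_smul]
    exact le_add_of_le_of_nonneg hle h.posSemidef.nonneg
  refine ⟨1 - (c + 1)⁻¹, ?_, ?_, ?_⟩
  · rw [sub_nonneg]
    exact inv_le_one_of_one_le₀ (by linarith)
  · have : 0 < (c + 1)⁻¹ := by positivity
    linarith
  · rw [le_iff] at hle' ⊢
    have := hle'.smul (inv_nonneg.2 hc1.le)
    convert this using 1
    rw [smul_sub, smul_smul, inv_mul_cancel₀ hc1.ne', one_smul, sub_smul, one_smul]
    abel

/-! ### The Lyapunov operator of a gain -/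

variable {n p m : ℕ}

/-- The operator `P ↦ (𝐀 + 𝐁 K)ᵀ (M ⊗ P) (𝐀 + 𝐁 K)`. -/
def lyap (S : NoisySystem n p m) (M : Matrix (Unit ⊕ Fin m) (Unit ⊕ Fin m) ℝ)
    (K : Matrix (Fin p) (Fin n) ℝ) (P : Matrix (Fin n) (Fin n) ℝ) : Matrix (Fin n) (Fin n) ℝ :=
  (S.stackedA + S.stackedB * K)ᵀ * (M ⊗ₖ P) * (S.stackedA + S.stackedB * K)

theorem kronecker_le_left {k l : Type*} [Fintype k] [Fintype l] {M : Matrix k k ℝ}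
    (hM : M.PosSemidef) {P P' : Matrix l l ℝ} (h : P ≤ P') : M ⊗ₖ P ≤ M ⊗ₖ P' := by
  rw [le_iff] at h ⊢
  have := hM.kronecker h
  rwa [sub_eq_add_neg, kronecker_add, ← neg_one_smul ℝ P, kronecker_smul, neg_one_smul,
    ← sub_eq_add_neg] at this

/-- Transfers an order between moment matrices to an order between expected quadratic costs. -/
theorem kronecker_le_right {k l : Type*} [Fintype k] [Fintype l] {M M' : Matrix k k ℝ}
    (h : M ≤ M') {P : Matrix l l ℝ} (hP : P.PosSemidef) : M ⊗ₖ P ≤ M' ⊗ₖ P := by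
  rw [le_iff] at h ⊢
  have := h.kronecker hP
  rwa [sub_eq_add_neg, add_kronecker, ← neg_one_smul ℝ M, smul_kronecker, neg_one_smul,
    ← sub_eq_add_neg] at this

theorem lyap_mono (S : NoisySystem n p m) {M : Matrix (Unit ⊕ Fin m) (Unit ⊕ Fin m) ℝ}
    (hM : M.PosSemidef) (K : Matrix (Fin p) (Fin n) ℝ) {P P' : Matrix (Fin n) (Fin n) ℝ}
    (h : P ≤ P') : lyap S M K P ≤ lyap S M K P' :=
  transpose_mul_mul_le (kronecker_le_left hM h) _

theorem lyap_nonneg (S : NoisySystem n p m) {M : Matrix (Unit ⊕ Fin m) (Unit ⊕ Fin m) ℝ}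
    (hM : M.PosSemidef) (K : Matrix (Fin p) (Fin n) ℝ) {P : Matrix (Fin n) (Fin n) ℝ}
    (h : P.PosSemidef) : (lyap S M K P).PosSemidef :=
  transpose_mul_mul_nonneg (hM.kronecker h) _

theorem lyap_smul (S : NoisySystem n p m) (M : Matrix (Unit ⊕ Fin m) (Unit ⊕ Fin m) ℝ)
    (K : Matrix (Fin p) (Fin n) ℝ) (c : ℝ) (P : Matrix (Fin n) (Fin n) ℝ) :
    lyap S M K (c • P) = c • lyap S M K P := by
  simp [lyap, kronecker_smul]

theorem lyap_sub (S : NoisySystem n p m) (M : Matrix (Unit ⊕ Fin m) (Unit ⊕ Fin m) ℝ)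
    (K : Matrix (Fin p) (Fin n) ℝ) (P P' : Matrix (Fin n) (Fin n) ℝ) :
    lyap S M K (P - P') = lyap S M K P - lyap S M K P' := by
  have : M ⊗ₖ (P - P') = M ⊗ₖ P - M ⊗ₖ P' := by
    ext; simp [kroneckerMap_apply, mul_sub]
  simp only [lyap, this, Matrix.mul_sub, Matrix.sub_mul]

/-- A Lyapunov certificate `W` for `K` forces every symmetric `X ≼ L_K(X)` to be
negative semidefinite. -/
theorem nonpos_of_le_lyap (S : NoisySystem n p m) {M : Matrix (Unit ⊕ Fin m) (Unit ⊕ Fin m) ℝ}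
    (hM : M.PosSemidef) {K : Matrix (Fin p) (Fin n) ℝ} {W X : Matrix (Fin n) (Fin n) ℝ}
    (hW : W.PosDef) (hWL : (W - lyap S M K W).PosDef) (hX : Xᵀ = X) (hXL : X ≤ lyap S M K X) :
    X ≤ 0 := by
  obtain ⟨ρ, hρ0, hρ1, hρ⟩ := exists_le_smul_of_posDef_sub hW hWL
  obtain ⟨c, hc, hcX⟩ := exists_le_smul_of_posDef hW hX
  -- Each application of the monotone operator to the bound on `X` gains a factor `ρ < 1`; letting
  -- `j` grow leaves `X ≼ 0`.
  have hiter : ∀ j : ℕ, X ≤ (c * ρ ^ j) • W := by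
    intro j
    induction j with
    | zero => simpa using hcX
    | succ j ih =>
      refine hXL.trans ((lyap_mono S hM K ih).trans ?_)
      rw [lyap_smul, pow_succ, ← mul_assoc, mul_smul _ ρ, le_iff, ← smul_sub]
      exact (le_iff.1 hρ).smul (by positivity)
  rw [le_iff, zero_sub, posSemidef_iff_real]
  refine ⟨by rw [transpose_neg, hX], fun x => ?_⟩
  rw [neg_mulVec, dotProduct_neg, neg_nonneg]
  have hlim : Tendsto (fun j : ℕ => c * ρ ^ j * (x ⬝ᵥ W *ᵥ x)) atTop (𝓝 0) := by
    simpa using ((tendsto_pow_atTop_nhds_zero_of_lt_one hρ0 hρ1).const_mul c).mul_const _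
  refine ge_of_tendsto' hlim fun j => ?_
  have := quad_le_quad (hiter j) x
  rwa [smul_mulVec, dotProduct_smul, smul_eq_mul] at this

/-! ### The Riccati operator -/

/-- At `(a, b)` the quadratic form is `(a + μ · b)² + bᵀ C b`. -/
theorem augmentedMoment_posSemidef (μ : Fin m → ℝ) {C : Matrix (Fin m) (Fin m) ℝ}
    (hC : C.PosSemidef) : (augmentedMoment μ C).PosSemidef := by
  rw [posSemidef_iff_real]
  constructor
  · rw [augmentedMoment, fromBlocks_transpose, transpose_add, PosSemidef.transpose_eq hC]
    congr 1
    congr 1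
    ext i j
    simp [vecMulVec_apply, mul_comm]
  · intro x
    have key : x ⬝ᵥ augmentedMoment μ C *ᵥ x =
        (x (Sum.inl ()) + μ ⬝ᵥ (x ∘ Sum.inr)) ^ 2 +
          (x ∘ Sum.inr) ⬝ᵥ C *ᵥ (x ∘ Sum.inr) := by
      have h1 : (x ∘ Sum.inr) ⬝ᵥ vecMulVec μ μ *ᵥ (x ∘ Sum.inr) =
          (μ ⬝ᵥ (x ∘ Sum.inr)) ^ 2 := by
        rw [vecMulVec_mulVec]
        simp [dotProduct_comm (x ∘ Sum.inr) μ, sq]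
      have h2 : ∀ a : Unit → ℝ, ∀ b : Fin m → ℝ, Sum.elim a b ⬝ᵥ augmentedMoment μ C *ᵥ Sum.elim a b
          = a () ^ 2 + 2 * a () * (μ ⬝ᵥ b) + b ⬝ᵥ vecMulVec μ μ *ᵥ b + b ⬝ᵥ C *ᵥ b := by
        intro a b
        rw [augmentedMoment, fromBlocks_mulVec]
        simp only [Sum.elim_comp_inl, Sum.elim_comp_inr, sumElim_dotProduct_sumElim, add_mulVec,
          dotProduct_add]
        have e1 : a ⬝ᵥ replicateRow Unit μ *ᵥ b = a () * (μ ⬝ᵥ b) := by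
          simp [dotProduct, mulVec]
        have e2 : b ⬝ᵥ replicateCol Unit μ *ᵥ a = a () * (μ ⬝ᵥ b) := by
          simp only [dotProduct, mulVec, replicateCol_apply, Finset.univ_unique,
            Finset.sum_singleton, Finset.mul_sum]
          exact Finset.sum_congr rfl fun i _ => by simp; ring
        have e3 : a ⬝ᵥ (1 : Matrix Unit Unit ℝ) *ᵥ a = a () ^ 2 := by
          simp [dotProduct, sq]
        rw [e1, e2, e3]
        ring
      rw [← Sum.elim_comp_inl_inr x, h2]
      simp only [Sum.elim_comp_inr, Sum.elim_inl, h1]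
      simp only [Function.comp_apply]
      ring
    rw [key]
    have := PosSemidef.quad_nonneg hC (x ∘ Sum.inr)
    positivity

/-- The right-hand side `Q + F(P) - H(P)ᵀ (R + G(P))⁻¹ H(P)` of the Riccati equation. -/
def riccatiOp (S : NoisySystem n p m) (Q : Matrix (Fin n) (Fin n) ℝ)
    (R : Matrix (Fin p) (Fin p) ℝ) (μ : Fin m → ℝ) (C : Matrix (Fin m) (Fin m) ℝ)
    (P : Matrix (Fin n) (Fin n) ℝ) : Matrix (Fin n) (Fin n) ℝ :=
  Q + opF S μ C P - (opH S μ C P)ᵀ * (R + opG S μ C P)⁻¹ * opH S μ C P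

/-- The operator `P ↦ Q + Kᵀ R K + L_K(P)`, the cost-to-go of one step with the gain `K`. -/
def bellmanOp (S : NoisySystem n p m) (Q : Matrix (Fin n) (Fin n) ℝ)
    (R : Matrix (Fin p) (Fin p) ℝ) (μ : Fin m → ℝ) (C : Matrix (Fin m) (Fin m) ℝ)
    (K : Matrix (Fin p) (Fin n) ℝ) (P : Matrix (Fin n) (Fin n) ℝ) : Matrix (Fin n) (Fin n) ℝ :=
  Q + Kᵀ * R * K + lyap S (augmentedMoment μ C) K P

variable {S : NoisySystem n p m} {Q : Matrix (Fin n) (Fin n) ℝ} {R : Matrix (Fin p) (Fin p) ℝ}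
  {μ : Fin m → ℝ} {C : Matrix (Fin m) (Fin m) ℝ}

theorem posDef_add_opG (hR : R.PosDef) (hC : C.PosSemidef) {P : Matrix (Fin n) (Fin n) ℝ}
    (hP : P.PosSemidef) : (R + opG S μ C P).PosDef :=
  hR.add_posSemidef
    (transpose_mul_mul_nonneg ((augmentedMoment_posSemidef μ hC).kronecker hP) _)

/-- Quadratic expansion of the one-step cost-to-go. -/
theorem quadratic_expansion (hC : C.PosSemidef) {P : Matrix (Fin n) (Fin n) ℝ}
    (hP : P.PosSemidef) {l : Type*} (X : Matrix (Fin n) l ℝ) (U : Matrix (Fin p) l ℝ) :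
    (S.stackedA * X + S.stackedB * U)ᵀ * (augmentedMoment μ C ⊗ₖ P) *
        (S.stackedA * X + S.stackedB * U) =
      Xᵀ * opF S μ C P * X + Xᵀ * (opH S μ C P)ᵀ * U + Uᵀ * opH S μ C P * X +
        Uᵀ * opG S μ C P * U := by
  have hW := PosSemidef.transpose_eq ((augmentedMoment_posSemidef μ hC).kronecker hP)
  simp only [opF, opG, opH, transpose_mul, transpose_add, transpose_transpose, hW,
    Matrix.add_mul, Matrix.mul_add, Matrix.mul_assoc]
  abel

/-- Completion of squares in the one-step cost-to-go. -/
theorem completion_of_squares (hR : R.PosDef) (hC : C.PosSemidef)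
    {P : Matrix (Fin n) (Fin n) ℝ} (hP : P.PosSemidef) {l : Type*}
    (X : Matrix (Fin n) l ℝ) (U : Matrix (Fin p) l ℝ) :
    Xᵀ * Q * X + Uᵀ * R * U + (S.stackedA * X + S.stackedB * U)ᵀ *
        (augmentedMoment μ C ⊗ₖ P) * (S.stackedA * X + S.stackedB * U) =
      Xᵀ * riccatiOp S Q R μ C P * X +
        (U - riccatiGain S R μ C P * X)ᵀ * (R + opG S μ C P) *
          (U - riccatiGain S R μ C P * X) := by
  have hD := posDef_add_opG (S := S) (μ := μ) hR hC hP
  have hDu := hD.isUnit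
  rw [isUnit_iff_isUnit_det] at hDu
  have hDt := PosSemidef.transpose_eq hD.posSemidef
  have hit : ((R + opG S μ C P)⁻¹)ᵀ = (R + opG S μ C P)⁻¹ := by
    rw [transpose_nonsing_inv, hDt]
  rw [quadratic_expansion hC hP]
  have hG : Uᵀ * R * U + Uᵀ * opG S μ C P * U = Uᵀ * (R + opG S μ C P) * U := by
    rw [Matrix.mul_add, Matrix.add_mul]
  unfold riccatiGain riccatiOp
  generalize R + opG S μ C P = D at *
  generalize opH S μ C P = H at *
  have e : (U - -(D⁻¹ * H) * X)ᵀ * D * (U - -(D⁻¹ * H) * X) =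
      Uᵀ * D * U + Uᵀ * H * X + Xᵀ * Hᵀ * U + Xᵀ * (Hᵀ * D⁻¹ * H) * X := by
    rw [Matrix.neg_mul, sub_neg_eq_add, transpose_add, Matrix.add_mul, Matrix.add_mul,
      Matrix.mul_add, Matrix.mul_add]
    have h1 : Uᵀ * D * (D⁻¹ * H * X) = Uᵀ * H * X := by
      rw [Matrix.mul_assoc Uᵀ D, Matrix.mul_assoc D⁻¹, mul_nonsing_inv_cancel_left _ _ hDu,
        ← Matrix.mul_assoc]
    have h2 : (D⁻¹ * H * X)ᵀ * D = Xᵀ * Hᵀ := by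
      rw [transpose_mul, transpose_mul, hit, Matrix.mul_assoc, Matrix.mul_assoc,
        nonsing_inv_mul _ hDu, Matrix.mul_one]
    rw [h1, h2]
    simp only [Matrix.mul_assoc]
    abel
  rw [e, ← hG]
  simp only [Matrix.mul_add, Matrix.mul_sub, Matrix.add_mul, Matrix.sub_mul]
  abel

/-- The completed square with `X = 1` and `U = K`; it exhibits `riccatiOp` as the Loewner minimum of
`bellmanOp` over all gains, attained at `riccatiGain`. -/
theorem bellmanOp_eq (hR : R.PosDef) (hC : C.PosSemidef) {P : Matrix (Fin n) (Fin n) ℝ}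
    (hP : P.PosSemidef) (K : Matrix (Fin p) (Fin n) ℝ) :
    bellmanOp S Q R μ C K P = riccatiOp S Q R μ C P +
      (K - riccatiGain S R μ C P)ᵀ * (R + opG S μ C P) * (K - riccatiGain S R μ C P) := by
  simpa [bellmanOp, lyap] using completion_of_squares (S := S) (Q := Q) (μ := μ) hR hC hP 1 K

theorem riccatiOp_le_bellmanOp (hR : R.PosDef) (hC : C.PosSemidef)
    {P : Matrix (Fin n) (Fin n) ℝ} (hP : P.PosSemidef) (K : Matrix (Fin p) (Fin n) ℝ) :
    riccatiOp S Q R μ C P ≤ bellmanOp S Q R μ C K P := by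
  rw [bellmanOp_eq hR hC hP K]
  exact le_add_of_nonneg_right
    (transpose_mul_mul_nonneg (posDef_add_opG hR hC hP).posSemidef _).nonneg

theorem bellmanOp_riccatiGain (hR : R.PosDef) (hC : C.PosSemidef)
    {P : Matrix (Fin n) (Fin n) ℝ} (hP : P.PosSemidef) :
    bellmanOp S Q R μ C (riccatiGain S R μ C P) P = riccatiOp S Q R μ C P := by
  rw [bellmanOp_eq hR hC hP, sub_self]
  simp

/-- A minimum of monotone operators is monotone: freeze the gain that is optimal for `P'` and use
it, suboptimally, for `P`. -/
theorem riccatiOp_mono (hR : R.PosDef) (hC : C.PosSemidef)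
    {P P' : Matrix (Fin n) (Fin n) ℝ} (hP : P.PosSemidef) (h : P ≤ P') :
    riccatiOp S Q R μ C P ≤ riccatiOp S Q R μ C P' := by
  have hP' : P'.PosSemidef := (hP.nonneg.trans h).posSemidef
  rw [← bellmanOp_riccatiGain hR hC hP']
  refine (riccatiOp_le_bellmanOp hR hC hP (riccatiGain S R μ C P')).trans ?_
  exact add_le_add_right (lyap_mono S (augmentedMoment_posSemidef μ hC) _ h) _

theorem riccatiOp_nonneg (hQ : Q.PosDef) (hR : R.PosDef) (hC : C.PosSemidef)
    {P : Matrix (Fin n) (Fin n) ℝ} (hP : P.PosSemidef) : (riccatiOp S Q R μ C P).PosSemidef := by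
  rw [← bellmanOp_riccatiGain hR hC hP]
  exact (hQ.posSemidef.add (transpose_mul_mul_nonneg hR.posSemidef _)).add
    (lyap_nonneg S (augmentedMoment_posSemidef μ hC) _ hP)

/-! ### The semidefinite program -/

/-- Schur complement with respect to the positive definite block `R + G(P)`. -/
theorem sdpFeasible_iff (hR : R.PosDef) (hC : C.PosSemidef) {P : Matrix (Fin n) (Fin n) ℝ} :
    SDPFeasible S Q R μ C P ↔ P.PosSemidef ∧ P ≤ riccatiOp S Q R μ C P := by
  rw [SDPFeasible, and_comm]
  refine and_congr_right fun hP => ?_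
  have hD := posDef_add_opG (S := S) (μ := μ) hR hC hP
  have : Invertible (R + opG S μ C P) := hD.isUnit.invertible
  have := hD.fromBlocks₂₂ (Q - P + opF S μ C P) (opH S μ C P)ᵀ
  rw [conjTranspose_eq_transpose_of_trivial, transpose_transpose] at this
  rw [this, le_iff, riccatiOp]
  have e : Q - P + opF S μ C P - (opH S μ C P)ᵀ * (R + opG S μ C P)⁻¹ * opH S μ C P =
    Q + opF S μ C P - (opH S μ C P)ᵀ * (R + opG S μ C P)⁻¹ * opH S μ C P - P := by abel
  rw [e]

/-- Comparison principle: in the difference `X = P' - P` the constant term `Q + Kᵀ R K` cancels,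
leaving `X ≼ L_K(X)`, which the certificate `W` only allows for `X ≼ 0`. -/
theorem sdpFeasible_le (hR : R.PosDef) (hC : C.PosSemidef)
    {K : Matrix (Fin p) (Fin n) ℝ} {W P' : Matrix (Fin n) (Fin n) ℝ} (hW : W.PosDef)
    (hWL : (W - lyap S (augmentedMoment μ C) K W).PosDef) {P : Matrix (Fin n) (Fin n) ℝ}
    (hPt : Pᵀ = P) (hP : bellmanOp S Q R μ C K P ≤ P) (hP' : SDPFeasible S Q R μ C P') :
    P' ≤ P := by
  rw [sdpFeasible_iff hR hC] at hP'
  rw [← sub_nonpos]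
  refine nonpos_of_le_lyap S (augmentedMoment_posSemidef μ hC) hW hWL ?_ ?_
  · rw [transpose_sub, PosSemidef.transpose_eq hP'.1, hPt]
  · rw [lyap_sub]
    have h := sub_le_sub (hP'.2.trans (riccatiOp_le_bellmanOp hR hC hP'.1 K)) hP
    rwa [bellmanOp, bellmanOp, add_sub_add_left_eq_sub] at h

/-- A gain with a Lyapunov certificate has an upper solution of its Bellman inequality. -/
theorem exists_bellmanOp_le (hQ : Q.PosDef) (hR : R.PosDef)
    {K : Matrix (Fin p) (Fin n) ℝ} {W : Matrix (Fin n) (Fin n) ℝ} (hW : W.PosDef)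
    (hWL : (W - lyap S (augmentedMoment μ C) K W).PosDef) :
    ∃ P : Matrix (Fin n) (Fin n) ℝ, P.PosSemidef ∧ bellmanOp S Q R μ C K P ≤ P := by
  -- `W` is scaled until its decrease `W - L_K(W)` absorbs the stage cost.
  obtain ⟨c, hc, h⟩ := exists_le_smul_of_posDef hWL (X := Q + Kᵀ * R * K)
    (PosSemidef.transpose_eq (hQ.posSemidef.add (transpose_mul_mul_nonneg hR.posSemidef K)))
  refine ⟨c • W, hW.posSemidef.smul hc.le, ?_⟩
  rw [bellmanOp, lyap_smul]
  rw [smul_sub] at h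
  exact le_sub_iff_add_le.1 h

/-! ### Compactness and existence of a Riccati solution -/

theorem abs_apply_le_of_posSemidef {k : Type*} [Fintype k] {M : Matrix k k ℝ}
    (hM : M.PosSemidef) (i j : k) : |M i j| ≤ (M i i + M j j) / 2 := by
  classical
  have ht : M j i = M i j := by
    conv_lhs => rw [← PosSemidef.transpose_eq hM]
    rfl
  -- The test vectors `e_i ± e_j` bound the off-diagonal entry on both sides.
  have h1 := PosSemidef.quad_nonneg hM (Pi.single i 1 + Pi.single j 1)
  have h2 := PosSemidef.quad_nonneg hM (Pi.single i 1 - Pi.single j 1)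
  simp only [mulVec_add, mulVec_sub, dotProduct_add, dotProduct_sub, add_dotProduct,
    sub_dotProduct, mulVec_single, single_dotProduct, MulOpposite.op_one, one_smul, one_mul,
    col_apply, ht] at h1 h2
  rw [abs_le]
  constructor <;> linarith

theorem isClosed_posSemidef {k : Type*} [Fintype k] :
    IsClosed {M : Matrix k k ℝ | M.PosSemidef} := by
  simp only [posSemidef_iff_real, Set.ofPred_and, Set.ofPred_forall]
  refine IsClosed.inter (isClosed_eq (by fun_prop) continuous_id) (isClosed_iInter fun x => ?_)
  exact isClosed_le continuous_const (by fun_prop)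

/-- The diagonal of `M` is bounded by that of `U`, and the diagonal controls all entries of a
positive semidefinite matrix. -/
theorem isCompact_posSemidef_Icc {k : Type*} [Fintype k] (U : Matrix k k ℝ) :
    IsCompact {M : Matrix k k ℝ | M.PosSemidef ∧ M ≤ U} := by
  have hbox : IsCompact (Set.pi Set.univ fun i => Set.pi Set.univ fun j =>
      Set.Icc (-((U i i + U j j) / 2)) ((U i i + U j j) / 2) : Set (k → k → ℝ)) :=
    isCompact_univ_pi fun i => isCompact_univ_pi fun j => isCompact_Icc
  refine IsCompact.of_isClosed_subset (X := k → k → ℝ) hbox ?_ ?_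
  · refine IsClosed.inter isClosed_posSemidef ?_
    exact isClosed_posSemidef.preimage (f := fun M : Matrix k k ℝ => U - M) (by fun_prop)
  · rintro M ⟨hM, hMU⟩ i - j -
    have hd : ∀ i, M i i ≤ U i i := fun i =>
      sub_nonneg.1 ((le_iff.1 hMU).diag_nonneg (i := i))
    have := abs_le.1 (abs_apply_le_of_posSemidef hM i j)
    constructor <;> linarith [hd i, hd j, this.1, this.2]

theorem continuous_opFGH :
    (Continuous fun P => opF S μ C P) ∧ (Continuous fun P => opG S μ C P) ∧
      Continuous fun P => opH S μ C P := by
  have h : Continuous fun P : Matrix (Fin n) (Fin n) ℝ => augmentedMoment μ C ⊗ₖ P := by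
    refine continuous_pi fun i => continuous_pi fun j => ?_
    simp only [kroneckerMap_apply]
    fun_prop
  refine ⟨?_, ?_, ?_⟩
  · exact (continuous_const.matrix_mul h).matrix_mul continuous_const
  · exact (continuous_const.matrix_mul h).matrix_mul continuous_const
  · exact (continuous_const.matrix_mul h).matrix_mul continuous_const

/-- In block form the constraint is continuous in `P`, with no inverse involved. -/
theorem isClosed_sdpFeasible : IsClosed {P | SDPFeasible S Q R μ C P} := by
  obtain ⟨hF, hG, hH⟩ := continuous_opFGH (S := S) (μ := μ) (C := C)
  refine IsClosed.inter ?_ isClosed_posSemidef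
  refine isClosed_posSemidef.preimage (f := fun P => fromBlocks (Q - P + opF S μ C P)
    (opH S μ C P)ᵀ (opH S μ C P) (R + opG S μ C P)) ?_
  exact Continuous.matrix_fromBlocks (by fun_prop) (by fun_prop) (by fun_prop) (by fun_prop)

/-- The feasible set is compact, contains `0`, and is mapped into itself by `riccatiOp`, which moves
each feasible point upwards. At a trace maximizer the increment is positive semidefinite with zero
trace, hence zero. -/
theorem exists_riccatiSolution (hQ : Q.PosDef) (hR : R.PosDef) (hC : C.PosSemidef)
    {K : Matrix (Fin p) (Fin n) ℝ} {W : Matrix (Fin n) (Fin n) ℝ} (hW : W.PosDef)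
    (hWL : (W - lyap S (augmentedMoment μ C) K W).PosDef) :
    ∃ P, IsRiccatiSolution S Q R μ C P := by
  obtain ⟨U, hU, hUle⟩ := exists_bellmanOp_le hQ hR hW hWL
  have hcomp : IsCompact {P | SDPFeasible S Q R μ C P} :=
    (isCompact_posSemidef_Icc U).of_isClosed_subset isClosed_sdpFeasible fun P hP =>
      ⟨hP.2, sdpFeasible_le hR hC hW hWL (PosSemidef.transpose_eq hU) hUle hP⟩
  have hne : {P | SDPFeasible S Q R μ C P}.Nonempty :=
    ⟨0, (sdpFeasible_iff hR hC).2 ⟨.zero, (riccatiOp_nonneg hQ hR hC .zero).nonneg⟩⟩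
  obtain ⟨P, hP, hmax⟩ := hcomp.exists_isMaxOn hne (f := fun P => P.trace)
    (by fun_prop)
  have hP' := (sdpFeasible_iff hR hC).1 hP
  have hnext : SDPFeasible S Q R μ C (riccatiOp S Q R μ C P) :=
    (sdpFeasible_iff hR hC).2 ⟨riccatiOp_nonneg hQ hR hC hP'.1, riccatiOp_mono hR hC hP'.1 hP'.2⟩
  have hps := le_iff.1 hP'.2
  have htr : (riccatiOp S Q R μ C P - P).trace = 0 := by
    refine le_antisymm ?_ hps.trace_nonneg
    rw [trace_sub, sub_nonpos]
    exact hmax hnext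
  exact ⟨P, hP'.1, (sub_eq_zero.1 (hps.trace_eq_zero_iff.1 htr)).symm⟩

/-! ### Maximality and uniqueness of the Riccati solution -/

section Solution

variable {P : Matrix (Fin n) (Fin n) ℝ}

theorem IsRiccatiSolution.sdpFeasible (hR : R.PosDef) (hC : C.PosSemidef)
    (h : IsRiccatiSolution S Q R μ C P) : SDPFeasible S Q R μ C P :=
  (sdpFeasible_iff hR hC).2 ⟨h.1, h.2.le⟩

theorem IsRiccatiSolution.bellmanOp_eq (hR : R.PosDef) (hC : C.PosSemidef)
    (h : IsRiccatiSolution S Q R μ C P) :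
    bellmanOp S Q R μ C (riccatiGain S R μ C P) P = P :=
  (bellmanOp_riccatiGain hR hC h.1).trans h.2.symm

/-- The decrease equals `Q + Kᵀ R K ≻ 0`, so a Riccati solution is a Lyapunov certificate for its
own gain. -/
theorem IsRiccatiSolution.posDef_sub_lyap (hQ : Q.PosDef) (hR : R.PosDef) (hC : C.PosSemidef)
    (h : IsRiccatiSolution S Q R μ C P) :
    (P - lyap S (augmentedMoment μ C) (riccatiGain S R μ C P) P).PosDef := by
  have h2 := h.bellmanOp_eq hR hC
  rw [bellmanOp] at h2
  rw [← eq_sub_iff_add_eq.2 h2]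
  exact hQ.add_posSemidef (transpose_mul_mul_nonneg hR.posSemidef _)

theorem IsRiccatiSolution.posDef (hQ : Q.PosDef) (hR : R.PosDef) (hC : C.PosSemidef)
    (h : IsRiccatiSolution S Q R μ C P) : P.PosDef := by
  have := (h.posDef_sub_lyap hQ hR hC).add_posSemidef
    (lyap_nonneg S (augmentedMoment_posSemidef μ hC) (riccatiGain S R μ C P) h.1)
  rwa [sub_add_cancel] at this

/-- The comparison principle with `P` as both certificate and upper solution. Being greatest among
feasible matrices gives uniqueness in the equation and in the program. -/
theorem IsRiccatiSolution.le_of_sdpFeasible (hQ : Q.PosDef) (hR : R.PosDef) (hC : C.PosSemidef)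
    (h : IsRiccatiSolution S Q R μ C P) {P' : Matrix (Fin n) (Fin n) ℝ}
    (hP' : SDPFeasible S Q R μ C P') : P' ≤ P :=
  sdpFeasible_le hR hC (h.posDef hQ hR hC) (h.posDef_sub_lyap hQ hR hC)
    (PosSemidef.transpose_eq h.1) (h.bellmanOp_eq hR hC).le hP'

theorem IsRiccatiSolution.isRiccatiSolution_iff (hQ : Q.PosDef) (hR : R.PosDef)
    (hC : C.PosSemidef) (h : IsRiccatiSolution S Q R μ C P) (P' : Matrix (Fin n) (Fin n) ℝ) :
    IsRiccatiSolution S Q R μ C P' ↔ P' = P := by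
  constructor
  · intro h'
    exact le_antisymm (h.le_of_sdpFeasible hQ hR hC (h'.sdpFeasible hR hC))
      (h'.le_of_sdpFeasible hQ hR hC (h.sdpFeasible hR hC))
  · rintro rfl
    exact h

theorem IsRiccatiSolution.isSDPSolution_iff (hQ : Q.PosDef) (hR : R.PosDef)
    (hC : C.PosSemidef) (h : IsRiccatiSolution S Q R μ C P) (P' : Matrix (Fin n) (Fin n) ℝ) :
    IsSDPSolution S Q R μ C P' ↔ P' = P := by
  constructor
  · rintro ⟨hf, hopt⟩
    have hps := le_iff.1 (h.le_of_sdpFeasible hQ hR hC hf)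
    have := hopt P (h.sdpFeasible hR hC)
    have htr : (P - P').trace = 0 := by
      refine le_antisymm ?_ hps.trace_nonneg
      rw [trace_sub]
      linarith
    exact (sub_eq_zero.1 (hps.trace_eq_zero_iff.1 htr)).symm
  · rintro rfl
    refine ⟨h.sdpFeasible hR hC, fun P'' hP'' => ?_⟩
    have := (le_iff.1 (h.le_of_sdpFeasible hQ hR hC hP'')).trace_nonneg
    rw [trace_sub] at this
    linarith

/-- Completion of squares along a state and an input. -/
theorem quad_completion (hR : R.PosDef) (hC : C.PosSemidef) (hP : P.PosSemidef)
    (x : Fin n → ℝ) (u : Fin p → ℝ) :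
    x ⬝ᵥ Q *ᵥ x + u ⬝ᵥ R *ᵥ u + (S.stackedA *ᵥ x + S.stackedB *ᵥ u) ⬝ᵥ
        (augmentedMoment μ C ⊗ₖ P) *ᵥ (S.stackedA *ᵥ x + S.stackedB *ᵥ u) =
      x ⬝ᵥ riccatiOp S Q R μ C P *ᵥ x +
        (u - riccatiGain S R μ C P *ᵥ x) ⬝ᵥ (R + opG S μ C P) *ᵥ
          (u - riccatiGain S R μ C P *ᵥ x) := by
  -- Vectors become one-column matrices, and the matrix identity is read at its single entry.
  have hq : ∀ {k : Type} [Fintype k] (M : Matrix k k ℝ) (y : k → ℝ),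
      ((replicateCol Unit y)ᵀ * M * replicateCol Unit y) () () = y ⬝ᵥ M *ᵥ y := by
    intro k _ M y
    rw [Matrix.mul_assoc, ← replicateCol_mulVec, mul_apply]
    rfl
  have h := congrFun (congrFun (completion_of_squares (S := S) (Q := Q) (μ := μ) hR hC hP
    (replicateCol Unit x) (replicateCol Unit u)) ()) ()
  have hA : S.stackedA * replicateCol Unit x + S.stackedB * replicateCol Unit u =
      replicateCol Unit (S.stackedA *ᵥ x + S.stackedB *ᵥ u) := by
    rw [replicateCol_add, replicateCol_mulVec, replicateCol_mulVec]
  have hK : replicateCol Unit u - riccatiGain S R μ C P * replicateCol Unit x =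
      replicateCol Unit (u - riccatiGain S R μ C P *ᵥ x) := by
    rw [← replicateCol_mulVec]
    rfl
  rw [hA, hK, Matrix.add_apply, Matrix.add_apply, Matrix.add_apply, hq, hq, hq, hq, hq] at h
  exact h

end Solution

end Loewner

section Moments

open scoped MatrixOrder

variable {n p m : ℕ}

/-! ### Second moments -/

/-- The vector `(1, v)`. -/
def augment (v : Fin m → ℝ) : Unit ⊕ Fin m → ℝ :=
  Sum.elim (fun _ => 1) v

/-- The matrix `E_ν[(1, v) (1, v)ᵀ]`. -/
def secondMoment (ν : ProbabilityMeasure (Fin m → ℝ)) :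
    Matrix (Unit ⊕ Fin m) (Unit ⊕ Fin m) ℝ :=
  Matrix.of fun a b => ∫ v, augment v a * augment v b ∂(ν : Measure (Fin m → ℝ))

/-- The combination of the blocks of `z` with the weights `(1, v)`. -/
def blockCombination (v : Fin m → ℝ) (z : (Unit ⊕ Fin m) × Fin n → ℝ) : Fin n → ℝ :=
  fun i => ∑ a, augment v a * z (a, i)

theorem stateMatrix_apply (S : NoisySystem n p m) (v : Fin m → ℝ) (i j : Fin n) :
    S.stateMatrix v i j = ∑ a, augment v a * S.stackedA (a, i) j := by
  simp [NoisySystem.stateMatrix, NoisySystem.stackedA, augment, Matrix.add_apply,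
    Matrix.sum_apply]

theorem inputMatrix_apply (S : NoisySystem n p m) (v : Fin m → ℝ) (i : Fin n) (j : Fin p) :
    S.inputMatrix v i j = ∑ a, augment v a * S.stackedB (a, i) j := by
  simp [NoisySystem.inputMatrix, NoisySystem.stackedB, augment, Matrix.add_apply,
    Matrix.sum_apply]

/-- Linearity of the step in `(1, v)` is why only second moments of the disturbance matter. -/
theorem step_eq_blockCombination (S : NoisySystem n p m) (v : Fin m → ℝ) (x : Fin n → ℝ)
    (u : Fin p → ℝ) : S.stateMatrix v *ᵥ x + S.inputMatrix v *ᵥ u =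
      blockCombination v (S.stackedA *ᵥ x + S.stackedB *ᵥ u) := by
  ext i
  simp only [Pi.add_apply, mulVec, dotProduct, blockCombination, stateMatrix_apply,
    inputMatrix_apply, mul_add, Finset.sum_add_distrib, Finset.sum_mul, Finset.mul_sum]
  congr 1 <;>
  · rw [Finset.sum_comm]
    simp only [mul_assoc]

theorem closedLoopMatrix_apply (S : NoisySystem n p m) (K : Matrix (Fin p) (Fin n) ℝ)
    (v : Fin m → ℝ) (i j : Fin n) : S.closedLoopMatrix K v i j =
      blockCombination v (fun a => (S.stackedA + S.stackedB * K) a j) i := by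
  have h := congrFun (step_eq_blockCombination S v (Pi.single j 1) (K *ᵥ Pi.single j 1)) i
  rw [mulVec_mulVec, mulVec_mulVec, ← add_mulVec, ← add_mulVec,
    mulVec_single_one, mulVec_single_one] at h
  exact h

theorem dotProduct_kronecker_mulVec (M : Matrix (Unit ⊕ Fin m) (Unit ⊕ Fin m) ℝ)
    (P : Matrix (Fin n) (Fin n) ℝ) (z z' : (Unit ⊕ Fin m) × Fin n → ℝ) :
    z ⬝ᵥ (M ⊗ₖ P) *ᵥ z' =
      ∑ a, ∑ b, M a b * ((fun i => z (a, i)) ⬝ᵥ P *ᵥ fun i => z' (b, i)) := by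
  simp only [dotProduct, mulVec, Fintype.sum_prod_type, kroneckerMap_apply, Finset.mul_sum]
  refine Finset.sum_congr rfl fun a _ => ?_
  rw [Finset.sum_comm]
  refine Finset.sum_congr rfl fun b _ => Finset.sum_congr rfl fun i _ =>
    Finset.sum_congr rfl fun j _ => ?_
  ring

theorem dotProduct_blockCombination (v : Fin m → ℝ) (P : Matrix (Fin n) (Fin n) ℝ)
    (z z' : (Unit ⊕ Fin m) × Fin n → ℝ) :
    blockCombination v z ⬝ᵥ P *ᵥ blockCombination v z' =
      ∑ a, ∑ b, (augment v a * augment v b) *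
        ((fun i => z (a, i)) ⬝ᵥ P *ᵥ fun i => z' (b, i)) := by
  have h : ∀ y, blockCombination v y = ∑ a, augment v a • fun i : Fin n => y (a, i) := by
    intro y
    ext i
    simp [blockCombination]
  rw [h z, h z', mulVec_sum, sum_dotProduct]
  refine Finset.sum_congr rfl fun a _ => ?_
  rw [dotProduct_sum]
  refine Finset.sum_congr rfl fun b _ => ?_
  rw [mulVec_smul, smul_dotProduct, dotProduct_smul, smul_eq_mul, smul_eq_mul, mul_assoc]

variable {ν : ProbabilityMeasure (Fin m → ℝ)}

theorem integrable_augment_mul (hν : SquareIntegrable ν) (a b : Unit ⊕ Fin m) :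
    Integrable (fun v => augment v a * augment v b) (ν : Measure (Fin m → ℝ)) := by
  have h : ∀ a : Unit ⊕ Fin m,
      MemLp (fun v : Fin m → ℝ => augment v a) 2 (ν : Measure (Fin m → ℝ)) := by
    rintro (a | i)
    · exact memLp_const 1
    · exact hν i
  exact (h a).integrable_mul (h b)

theorem integrable_quad_blockCombination (hν : SquareIntegrable ν) (P : Matrix (Fin n) (Fin n) ℝ)
    (z z' : (Unit ⊕ Fin m) × Fin n → ℝ) :
    Integrable (fun v => blockCombination v z ⬝ᵥ P *ᵥ blockCombination v z')
      (ν : Measure (Fin m → ℝ)) := by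
  simp only [dotProduct_blockCombination]
  exact integrable_finsetSum _ fun a _ => integrable_finsetSum _ fun b _ =>
    (integrable_augment_mul hν a b).mul_const _

theorem integral_quad_blockCombination (hν : SquareIntegrable ν) (P : Matrix (Fin n) (Fin n) ℝ)
    (z z' : (Unit ⊕ Fin m) × Fin n → ℝ) :
    ∫ v, blockCombination v z ⬝ᵥ P *ᵥ blockCombination v z' ∂(ν : Measure (Fin m → ℝ)) =
      z ⬝ᵥ (secondMoment ν ⊗ₖ P) *ᵥ z' := by
  simp only [dotProduct_blockCombination, dotProduct_kronecker_mulVec]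
  rw [integral_finsetSum _ fun a _ => integrable_finsetSum _ fun b _ =>
    (integrable_augment_mul hν a b).mul_const _]
  refine Finset.sum_congr rfl fun a _ => ?_
  rw [integral_finsetSum _ fun b _ => (integrable_augment_mul hν a b).mul_const _]
  refine Finset.sum_congr rfl fun b _ => ?_
  rw [integral_mul_const]
  rfl

theorem lyapunovExpectation_eq (hν : SquareIntegrable ν) (S : NoisySystem n p m)
    (K : Matrix (Fin p) (Fin n) ℝ) (P : Matrix (Fin n) (Fin n) ℝ) :
    lyapunovExpectation S K P ν = lyap S (secondMoment ν) K P := by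
  have h : ∀ {k l : Type} [Fintype k] (B : Matrix k l ℝ) (M : Matrix k k ℝ) (i j : l),
      (Bᵀ * M * B) i j = (fun a => B a i) ⬝ᵥ M *ᵥ fun a => B a j := by
    intro k l _ B M i j
    rw [Matrix.mul_assoc]
    rfl
  ext i j
  rw [lyap, h, ← integral_quad_blockCombination hν, lyapunovExpectation, of_apply]
  refine integral_congr_ae (.of_forall fun v => ?_)
  simp only [h, closedLoopMatrix_apply]

/-- The expected quadratic cost-to-go after one step. -/
theorem lintegral_quad_step (hν : SquareIntegrable ν) (S : NoisySystem n p m)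
    {P : Matrix (Fin n) (Fin n) ℝ} (hP : P.PosSemidef) (x : Fin n → ℝ) (u : Fin p → ℝ) :
    ∫⁻ v, ENNReal.ofReal ((S.stateMatrix v *ᵥ x + S.inputMatrix v *ᵥ u) ⬝ᵥ P *ᵥ
        (S.stateMatrix v *ᵥ x + S.inputMatrix v *ᵥ u)) ∂(ν : Measure (Fin m → ℝ)) =
      ENNReal.ofReal ((S.stackedA *ᵥ x + S.stackedB *ᵥ u) ⬝ᵥ (secondMoment ν ⊗ₖ P) *ᵥ
        (S.stackedA *ᵥ x + S.stackedB *ᵥ u)) := by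
  simp only [step_eq_blockCombination]
  rw [← integral_quad_blockCombination hν, ofReal_integral_eq_lintegral_ofReal
    (integrable_quad_blockCombination hν _ _ _) (.of_forall fun v => PosSemidef.quad_nonneg hP _)]

theorem secondMoment_eq (hν : SquareIntegrable ν) :
    secondMoment ν = augmentedMoment (mean ν) (covAbout (mean ν) ν) := by
  have hi : ∀ i, Integrable (fun v : Fin m → ℝ => v i) (ν : Measure (Fin m → ℝ)) := fun i =>
    (hν i).integrable (by norm_num)
  have hij : ∀ i j, Integrable (fun v : Fin m → ℝ => v i * v j) (ν : Measure (Fin m → ℝ)) :=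
    fun i j => (hν i).integrable_mul (hν j)
  ext (a | i) (b | j)
  · simp [secondMoment, augmentedMoment, augment]
  · simp [secondMoment, augmentedMoment, augment, mean]
  · simp [secondMoment, augmentedMoment, augment, mean]
  · simp only [secondMoment, augmentedMoment, augment, of_apply, Sum.elim_inr,
      fromBlocks_apply₂₂, Matrix.add_apply, covAbout, vecMulVec_apply]
    have e : ∀ v : Fin m → ℝ, (v i - mean ν i) * (v j - mean ν j) =
        v i * v j - v i * mean ν j - (mean ν i * v j - mean ν i * mean ν j) := fun v => by ring
    simp only [e]
    have h1 : Integrable (fun v : Fin m → ℝ => v i * mean ν j) (ν : Measure (Fin m → ℝ)) :=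
      (hi i).mul_const _
    have h2 : Integrable (fun v : Fin m → ℝ => mean ν i * v j) (ν : Measure (Fin m → ℝ)) :=
      (hi j).const_mul _
    have h3 : Integrable (fun _ : Fin m → ℝ => mean ν i * mean ν j)
        (ν : Measure (Fin m → ℝ)) := integrable_const _
    have h4 : Integrable (fun v : Fin m → ℝ => v i * v j - v i * mean ν j)
        (ν : Measure (Fin m → ℝ)) := (hij i j).sub h1
    have h5 : Integrable (fun v : Fin m → ℝ => mean ν i * v j - mean ν i * mean ν j)
        (ν : Measure (Fin m → ℝ)) := h2.sub h3
    rw [integral_sub h4 h5, integral_sub (hij i j) h1, integral_sub h2 h3, integral_mul_const,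
      integral_const_mul]
    simp only [integral_const, probReal_univ, one_smul]
    have hm : ∀ i, ∫ v : Fin m → ℝ, v i ∂(ν : Measure (Fin m → ℝ)) = mean ν i := fun i => rfl
    rw [hm, hm]
    ring

theorem augmentedMoment_mono (μ : Fin m → ℝ) {C C' : Matrix (Fin m) (Fin m) ℝ} (h : C ≤ C') :
    augmentedMoment μ C ≤ augmentedMoment μ C' := by
  rw [le_iff] at h ⊢
  -- With the mean fixed, the difference is `C' - C` padded by zeros, written as a congruence.
  have e : augmentedMoment μ C' - augmentedMoment μ C =
      (fromCols (0 : Matrix (Fin m) Unit ℝ) (1 : Matrix (Fin m) (Fin m) ℝ))ᵀ * (C' - C) *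
        fromCols (0 : Matrix (Fin m) Unit ℝ) (1 : Matrix (Fin m) (Fin m) ℝ) := by
    rw [transpose_fromCols, fromRows_mul, fromRows_mul_fromCols]
    ext (a | i) (b | j) <;> simp [augmentedMoment]
  rw [e]
  exact transpose_mul_mul_nonneg h _

theorem secondMoment_le {μ : Fin m → ℝ} {C : Matrix (Fin m) (Fin m) ℝ}
    (hν : ν ∈ ambiguitySet μ C) : secondMoment ν ≤ augmentedMoment μ C := by
  obtain ⟨h1, h2, rfl⟩ := hν
  rw [secondMoment_eq h1]
  exact augmentedMoment_mono _ h2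

/-! ### A distribution that attains the covariance bound -/

/-- Factor `C = Bᵀ B` and take the uniform law on the points `μ ± √(m+1) b`, with `b` ranging over
the rows of `B` and one zero row. The signs fix the mean, and `√(m+1)` compensates the weights
`1/(2(m+1))`. -/
theorem exists_mem_ambiguitySet_secondMoment_eq (μ : Fin m → ℝ) {C : Matrix (Fin m) (Fin m) ℝ}
    (hC : C.PosSemidef) :
    ∃ ν ∈ ambiguitySet μ C, secondMoment ν = augmentedMoment μ C := by
  obtain ⟨B, hB⟩ : ∃ B : Matrix (Fin m) (Fin m) ℝ, C = Bᵀ * B := by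
    obtain ⟨B, hB⟩ := CStarAlgebra.nonneg_iff_eq_star_mul_self.1 hC.nonneg
    exact ⟨B, by rw [hB, star_eq_conjTranspose, conjTranspose_eq_transpose_of_trivial]⟩
  -- The extra zero row keeps the support nonempty when `m = 0`.
  let row : Option (Fin m) → Fin m → ℝ := fun o => o.elim 0 B
  let sgn : Bool → ℝ := fun s => if s then 1 else -1
  let pt : Option (Fin m) × Bool → Fin m → ℝ := fun q =>
    μ + (sgn q.2 * √(m + 1)) • row q.1
  let _ : MeasurableSpace (Option (Fin m) × Bool) := ⊤
  let U := PMF.uniformOfFintype (Option (Fin m) × Bool)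
  have hpt : Measurable pt := fun _ _ => trivial
  let ν₁ : ProbabilityMeasure (Option (Fin m) × Bool) := ⟨U.toMeasure, inferInstance⟩
  let ν : ProbabilityMeasure (Fin m → ℝ) := ν₁.map hpt.aemeasurable
  have hmap : (ν : Measure (Fin m → ℝ)) = U.toMeasure.map pt := rfl
  have hint : ∀ f : (Fin m → ℝ) → ℝ, Continuous f → ∫ v, f v ∂(ν : Measure (Fin m → ℝ)) =
      ((m + 1) * 2 : ℝ)⁻¹ * ∑ o, (f (μ + √(m + 1) • row o) + f (μ - √(m + 1) • row o)) := by
    intro f hf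
    rw [hmap, integral_map hpt.aemeasurable hf.aestronglyMeasurable, PMF.integral_eq_sum,
      Fintype.sum_prod_type, Finset.mul_sum]
    refine Finset.sum_congr rfl fun o _ => ?_
    have hm : ((m : ℝ≥0∞) + 1).toReal = m + 1 := by
      rw [ENNReal.toReal_add (by simp) (by simp)]
      simp
    simp [U, pt, sgn, sub_eq_add_neg, hm]
    ring
  have hmean : mean ν = μ := by
    ext i
    rw [mean, hint _ (continuous_apply i)]
    have : (m : ℝ) + 1 ≠ 0 := by positivity
    simp
    field_simp
    ring
  have hcov : covAbout μ ν = C := by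
    ext i j
    rw [covAbout, of_apply, hint (fun v => (v i - μ i) * (v j - μ j)) (by fun_prop), hB]
    have h0 : (0 : ℝ) ≤ m + 1 := by positivity
    have h1 : (m : ℝ) + 1 ≠ 0 := by positivity
    have h2 : ∀ o, ((μ + √(m + 1) • row o) i - μ i) * ((μ + √(m + 1) • row o) j - μ j) +
        ((μ - √(m + 1) • row o) i - μ i) * ((μ - √(m + 1) • row o) j - μ j) =
        (m + 1) * 2 * (row o i * row o j) := by
      intro o
      simp only [Pi.add_apply, Pi.sub_apply, Pi.smul_apply, smul_eq_mul]
      linear_combination (2 * (row o i * row o j)) * Real.mul_self_sqrt h0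
    simp only [h2]
    rw [← Finset.mul_sum, inv_mul_cancel_left₀ (by positivity), Fintype.sum_option]
    have hnone : row none i * row none j = 0 := zero_mul (0 : ℝ)
    rw [hnone, zero_add, mul_apply]
    rfl
  have hsq : SquareIntegrable ν := by
    intro i
    rw [hmap, memLp_map_measure_iff (continuous_apply i).aestronglyMeasurable hpt.aemeasurable]
    exact MemLp.of_discrete
  refine ⟨ν, ⟨hsq, by rw [hcov, sub_self]; exact .zero, hmean⟩, ?_⟩
  rw [secondMoment_eq hsq, hmean, hcov]

/-- The maximum dominates the expectation at the attaining distribution, which is the nominal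
Lyapunov operator. -/
theorem exists_lyapunov_certificate {S : NoisySystem n p m} {μ : Fin m → ℝ}
    {C : Matrix (Fin m) (Fin m) ℝ} (hC : C.PosSemidef)
    (h : DRStabilizable S (ambiguitySet μ C)) :
    ∃ (K : Matrix (Fin p) (Fin n) ℝ) (W : Matrix (Fin n) (Fin n) ℝ), W.PosDef ∧
      (W - lyap S (augmentedMoment μ C) K W).PosDef := by
  obtain ⟨K, W, M, hW, -, hM, hWM⟩ := h
  obtain ⟨ν, hν, hν'⟩ := exists_mem_ambiguitySet_secondMoment_eq μ hC
  refine ⟨K, W, hW, ?_⟩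
  have := hWM.add_posSemidef (hM ν hν)
  rwa [sub_add_sub_cancel, lyapunovExpectation_eq hν.1, hν'] at this

end Moments

section Past

variable {n p m : ℕ}

/-! ### Processes driven by the past disturbances -/

/-- The random variable `f` is a Borel function of `w₀, …, w_{k-1}`. -/
def DependsOnPast {α : Type*} [MeasurableSpace α] (k : ℕ) (f : (ℕ → Fin m → ℝ) → α) : Prop :=
  ∃ g : (Fin k → Fin m → ℝ) → α, Measurable g ∧ ∀ w, f w = g fun i => w i

theorem DependsOnPast.measurable {α : Type*} [MeasurableSpace α] {k : ℕ}
    {f : (ℕ → Fin m → ℝ) → α} (h : DependsOnPast k f) : Measurable f := by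
  obtain ⟨g, hg, hfg⟩ := h
  rw [funext hfg]
  exact hg.comp (by fun_prop)

theorem DependsOnPast.comp {α β : Type*} [MeasurableSpace α] [MeasurableSpace β] {k : ℕ}
    {f : (ℕ → Fin m → ℝ) → α} (h : DependsOnPast k f) {φ : α → β} (hφ : Measurable φ) :
    DependsOnPast k fun w => φ (f w) := by
  obtain ⟨g, hg, hfg⟩ := h
  exact ⟨fun y => φ (g y), hφ.comp hg, fun w => congrArg φ (hfg w)⟩

theorem DependsOnPast.prodMk {α β : Type*} [MeasurableSpace α] [MeasurableSpace β] {k : ℕ}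
    {f : (ℕ → Fin m → ℝ) → α} {g : (ℕ → Fin m → ℝ) → β} (hf : DependsOnPast k f)
    (hg : DependsOnPast k g) : DependsOnPast k fun w => (f w, g w) := by
  obtain ⟨f', hf', hff⟩ := hf
  obtain ⟨g', hg', hgg⟩ := hg
  exact ⟨fun y => (f' y, g' y), hf'.prodMk hg', fun w => Prod.ext (hff w) (hgg w)⟩

theorem DependsOnPast.succ {α β : Type*} [MeasurableSpace α] [MeasurableSpace β] {k : ℕ}
    {f : (ℕ → Fin m → ℝ) → α} (h : DependsOnPast k f) {φ : (Fin m → ℝ) × α → β}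
    (hφ : Measurable φ) : DependsOnPast (k + 1) fun w => φ (w k, f w) := by
  obtain ⟨g, hg, hfg⟩ := h
  -- Among `w₀, …, w_k`, the last entry is the new disturbance and the others are the past of time
  -- `k`.
  refine ⟨fun y => φ (y (Fin.last k), g fun i => y i.castSucc), ?_, fun w => by simp [hfg]⟩
  exact hφ.comp (Measurable.prodMk (by fun_prop) (hg.comp (by fun_prop)))

theorem continuous_step (S : NoisySystem n p m) :
    Continuous fun q : (Fin m → ℝ) × (Fin n → ℝ) × (Fin p → ℝ) =>
      S.stateMatrix q.1 *ᵥ q.2.1 + S.inputMatrix q.1 *ᵥ q.2.2 := by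
  have h1 : Continuous fun v => S.stateMatrix v := by
    unfold NoisySystem.stateMatrix
    fun_prop
  have h2 : Continuous fun v => S.inputMatrix v := by
    unfold NoisySystem.inputMatrix
    fun_prop
  fun_prop

theorem dependsOnPast_stateTraj (S : NoisySystem n p m) (x₀ : Fin n → ℝ)
    {u : ℕ → (ℕ → Fin m → ℝ) → Fin p → ℝ} (hu : Admissible u) (k : ℕ) :
    DependsOnPast k fun w => stateTraj S x₀ u w k := by
  induction k with
  | zero => exact ⟨fun _ => x₀, measurable_const, fun w => rfl⟩
  | succ k ih => exact (ih.prodMk (hu k)).succ (continuous_step S).measurable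

theorem dependsOnPast_closedLoop (S : NoisySystem n p m) (K : Matrix (Fin p) (Fin n) ℝ)
    (x₀ : Fin n → ℝ) (k : ℕ) : DependsOnPast k fun w => closedLoop S K x₀ w k := by
  induction k with
  | zero => exact ⟨fun _ => x₀, measurable_const, fun w => rfl⟩
  | succ k ih =>
    have h := (ih.prodMk (ih.comp (φ := fun x => K *ᵥ x)
      (Continuous.measurable (by fun_prop)))).succ (continuous_step S).measurable
    simpa only [closedLoop, NoisySystem.closedLoopMatrix, Matrix.add_mulVec,
      Matrix.mulVec_mulVec] using h

theorem admissible_feedbackInput (S : NoisySystem n p m) (K : Matrix (Fin p) (Fin n) ℝ)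
    (x₀ : Fin n → ℝ) : Admissible (feedbackInput S K x₀) := fun k =>
  (dependsOnPast_closedLoop S K x₀ k).comp (φ := fun x => K *ᵥ x)
    (Continuous.measurable (by fun_prop))

instance (ν : ProbabilityMeasure (Fin m → ℝ)) : IsProbabilityMeasure (iidLaw ν) := by
  unfold iidLaw
  infer_instance

open ProbabilityTheory in
/-- The disturbance `w_k` may be integrated out independently of the past. -/
theorem DependsOnPast.lintegral_eq {α : Type*} [MeasurableSpace α] {k : ℕ}
    {f : (ℕ → Fin m → ℝ) → α} (h : DependsOnPast k f) (ν : ProbabilityMeasure (Fin m → ℝ))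
    {φ : (Fin m → ℝ) × α → ℝ≥0∞} (hφ : Measurable φ) :
    ∫⁻ w, φ (w k, f w) ∂(iidLaw ν) =
      ∫⁻ w, ∫⁻ v, φ (v, f w) ∂(ν : Measure (Fin m → ℝ)) ∂(iidLaw ν) := by
  have hf := h.measurable
  obtain ⟨g, hg, hfg⟩ := h
  have hind : IndepFun (fun w : ℕ → Fin m → ℝ => w k) f (iidLaw ν) := by
    have h0 : iIndepFun (fun i (w : ℕ → Fin m → ℝ) => w i) (iidLaw ν) :=
      iIndepFun_infinitePi (P := fun _ : ℕ => (ν : Measure (Fin m → ℝ)))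
        (X := fun _ v => v) fun _ => measurable_id
    -- The past uses only indices below `k`, disjoint from `{k}`; independence then makes the joint
    -- law a product.
    have h1 := h0.indepFun_finset {k} (Finset.range k) (by simp) fun i => by fun_prop
    have hφ' : Measurable fun y : ({k} : Finset ℕ) → Fin m → ℝ =>
        y ⟨k, Finset.mem_singleton_self k⟩ := measurable_pi_apply _
    have hψ : Measurable fun y : Finset.range k → Fin m → ℝ =>
        g fun i : Fin k => y ⟨i, Finset.mem_range.2 i.2⟩ :=
      hg.comp (measurable_pi_lambda _ fun _ => measurable_pi_apply _)
    have h2 := h1.comp hφ' hψ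
    rw [funext hfg]
    exact h2
  have hk : (iidLaw ν).map (fun w => w k) = (ν : Measure (Fin m → ℝ)) :=
    Measure.infinitePi_map_eval _ k
  have hmap := (indepFun_iff_map_prod_eq_prod_map_map (measurable_pi_apply k).aemeasurable
    hf.aemeasurable).1 hind
  rw [hk] at hmap
  have : IsProbabilityMeasure ((iidLaw ν).map f) := Measure.isProbabilityMeasure_map hf.aemeasurable
  calc ∫⁻ w, φ (w k, f w) ∂(iidLaw ν)
      = ∫⁻ q, φ q ∂((iidLaw ν).map fun w => (w k, f w)) :=
        (lintegral_map hφ ((measurable_pi_apply k).prodMk hf)).symm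
    _ = ∫⁻ a, ∫⁻ v, φ (v, a) ∂(ν : Measure (Fin m → ℝ)) ∂((iidLaw ν).map f) := by
        rw [hmap, lintegral_prod_symm' _ hφ]
    _ = _ := lintegral_map hφ.lintegral_prod_left' hf

end Past

section Cost

open scoped MatrixOrder

variable {n p m : ℕ} {S : NoisySystem n p m} {Q : Matrix (Fin n) (Fin n) ℝ}
  {R : Matrix (Fin p) (Fin p) ℝ} {μ : Fin m → ℝ} {C : Matrix (Fin m) (Fin m) ℝ}
  {P : Matrix (Fin n) (Fin n) ℝ} {u : ℕ → (ℕ → Fin m → ℝ) → Fin p → ℝ}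
  {ν : ProbabilityMeasure (Fin m → ℝ)}

/-! ### Expected costs -/

/-- The expected stage cost `E[x_kᵀ Q x_k + u_kᵀ R u_k]`. -/
def stageCost (S : NoisySystem n p m) (Q : Matrix (Fin n) (Fin n) ℝ)
    (R : Matrix (Fin p) (Fin p) ℝ) (x₀ : Fin n → ℝ)
    (u : ℕ → (ℕ → Fin m → ℝ) → Fin p → ℝ) (ν : ProbabilityMeasure (Fin m → ℝ)) (k : ℕ) : ℝ≥0∞ :=
  ∫⁻ w, ENNReal.ofReal
    (stateTraj S x₀ u w k ⬝ᵥ Q *ᵥ stateTraj S x₀ u w k + u k w ⬝ᵥ R *ᵥ u k w) ∂(iidLaw ν)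

/-- The expectation `E[x_kᵀ P x_k]`. -/
def stateEnergy (S : NoisySystem n p m) (P : Matrix (Fin n) (Fin n) ℝ) (x₀ : Fin n → ℝ)
    (u : ℕ → (ℕ → Fin m → ℝ) → Fin p → ℝ) (ν : ProbabilityMeasure (Fin m → ℝ)) (k : ℕ) : ℝ≥0∞ :=
  ∫⁻ w, ENNReal.ofReal (stateTraj S x₀ u w k ⬝ᵥ P *ᵥ stateTraj S x₀ u w k) ∂(iidLaw ν)

theorem measurable_stateTraj (S : NoisySystem n p m) (x₀ : Fin n → ℝ) (hu : Admissible u)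
    (k : ℕ) : Measurable fun w => stateTraj S x₀ u w k :=
  (dependsOnPast_stateTraj S x₀ hu k).measurable

theorem measurable_input (hu : Admissible u) (k : ℕ) : Measurable (u k) :=
  DependsOnPast.measurable (hu k)

theorem measurable_ofReal_quad {k : Type*} [Fintype k] (M : Matrix k k ℝ) :
    Measurable fun x : k → ℝ => ENNReal.ofReal (x ⬝ᵥ M *ᵥ x) :=
  ENNReal.measurable_ofReal.comp (continuous_quad M).measurable

theorem measurable_stage (S : NoisySystem n p m) (Q : Matrix (Fin n) (Fin n) ℝ)
    (R : Matrix (Fin p) (Fin p) ℝ) (x₀ : Fin n → ℝ) (hu : Admissible u) (k : ℕ) :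
    Measurable fun w => ENNReal.ofReal
      (stateTraj S x₀ u w k ⬝ᵥ Q *ᵥ stateTraj S x₀ u w k + u k w ⬝ᵥ R *ᵥ u k w) := by
  refine ENNReal.measurable_ofReal.comp (Measurable.add ?_ ?_)
  · exact (continuous_quad Q).measurable.comp (measurable_stateTraj S x₀ hu k)
  · exact (continuous_quad R).measurable.comp (measurable_input hu k)

theorem expectedCost_eq_tsum (x₀ : Fin n → ℝ) (hu : Admissible u) :
    expectedCost S Q R x₀ u ν = ∑' k, stageCost S Q R x₀ u ν k :=
  lintegral_tsum fun k => (measurable_stage S Q R x₀ hu k).aemeasurable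

theorem stateEnergy_zero (P : Matrix (Fin n) (Fin n) ℝ) (x₀ : Fin n → ℝ) :
    stateEnergy S P x₀ u ν 0 = ENNReal.ofReal (x₀ ⬝ᵥ P *ᵥ x₀) := by
  simp [stateEnergy, stateTraj]

/-- Integrates out `w_k` with the state and input at time `k` held fixed. -/
theorem stateEnergy_succ (hν : SquareIntegrable ν) (hP : P.PosSemidef) (x₀ : Fin n → ℝ)
    (hu : Admissible u) (k : ℕ) :
    stateEnergy S P x₀ u ν (k + 1) = ∫⁻ w, ENNReal.ofReal
      ((S.stackedA *ᵥ stateTraj S x₀ u w k + S.stackedB *ᵥ u k w) ⬝ᵥ (secondMoment ν ⊗ₖ P) *ᵥ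
        (S.stackedA *ᵥ stateTraj S x₀ u w k + S.stackedB *ᵥ u k w)) ∂(iidLaw ν) := by
  have h := ((dependsOnPast_stateTraj S x₀ hu k).prodMk (hu k)).lintegral_eq ν
    ((measurable_ofReal_quad P).comp (continuous_step S).measurable)
  simp only [Function.comp_apply, lintegral_quad_step hν S hP] at h
  exact h

theorem stageCost_add_stateEnergy (hν : SquareIntegrable ν) (hQ : Q.PosDef) (hR : R.PosDef)
    (hP : P.PosSemidef) (hM : (secondMoment ν).PosSemidef) (x₀ : Fin n → ℝ)
    (hu : Admissible u) (k : ℕ) :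
    stageCost S Q R x₀ u ν k + stateEnergy S P x₀ u ν (k + 1) = ∫⁻ w, ENNReal.ofReal
      (stateTraj S x₀ u w k ⬝ᵥ Q *ᵥ stateTraj S x₀ u w k + u k w ⬝ᵥ R *ᵥ u k w +
      (S.stackedA *ᵥ stateTraj S x₀ u w k + S.stackedB *ᵥ u k w) ⬝ᵥ (secondMoment ν ⊗ₖ P) *ᵥ
        (S.stackedA *ᵥ stateTraj S x₀ u w k + S.stackedB *ᵥ u k w)) ∂(iidLaw ν) := by
  rw [stateEnergy_succ hν hP x₀ hu, stageCost,
    ← lintegral_add_left (measurable_stage S Q R x₀ hu k)]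
  refine lintegral_congr fun w => ?_
  rw [ENNReal.ofReal_add (add_nonneg (PosSemidef.quad_nonneg hQ.posSemidef _)
    (PosSemidef.quad_nonneg hR.posSemidef _)) (PosSemidef.quad_nonneg (hM.kronecker hP) _)]

theorem secondMoment_posSemidef (hν : SquareIntegrable ν) : (secondMoment ν).PosSemidef := by
  rw [posSemidef_iff_real]
  constructor
  · ext a b
    simp [secondMoment, mul_comm]
  · intro y
    -- With one-dimensional blocks this reads `yᵀ E[(1,v)(1,v)ᵀ] y = E[((1,v) · y)²]`.
    have h := integral_quad_blockCombination (n := 1) hν 1 (fun q => y q.1) (fun q => y q.1)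
    rw [dotProduct_kronecker_mulVec] at h
    have e : y ⬝ᵥ secondMoment ν *ᵥ y = ∑ a, ∑ b, secondMoment ν a b *
        ((fun _ : Fin 1 => y a) ⬝ᵥ (1 : Matrix (Fin 1) (Fin 1) ℝ) *ᵥ fun _ => y b) := by
      simp only [dotProduct, mulVec, Finset.mul_sum]
      refine Finset.sum_congr rfl fun a _ => Finset.sum_congr rfl fun b _ => ?_
      simp
      ring
    rw [e, ← h]
    exact integral_nonneg fun v => PosSemidef.quad_nonneg .one _

/-! ### The upper bound -/

/-- Passing to the nominal moments can only increase the cost-to-go, and for the Riccati gain the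
completed square vanishes. -/
theorem stageCost_add_stateEnergy_le (hQ : Q.PosDef) (hR : R.PosDef) (hC : C.PosSemidef)
    (h : IsRiccatiSolution S Q R μ C P) (hν : ν ∈ ambiguitySet μ C) (x₀ : Fin n → ℝ) (k : ℕ) :
    stageCost S Q R x₀ (feedbackInput S (riccatiGain S R μ C P) x₀) ν k +
        stateEnergy S P x₀ (feedbackInput S (riccatiGain S R μ C P) x₀) ν (k + 1) ≤
      stateEnergy S P x₀ (feedbackInput S (riccatiGain S R μ C P) x₀) ν k := by
  rw [stageCost_add_stateEnergy hν.1 hQ hR h.1 (secondMoment_posSemidef hν.1) x₀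
    (admissible_feedbackInput S _ x₀)]
  refine lintegral_mono fun w => ENNReal.ofReal_le_ofReal ?_
  refine (add_le_add_right
    (quad_le_quad (kronecker_le_right (secondMoment_le hν) h.1) _) _).trans ?_
  rw [quad_completion hR hC h.1]
  have hr : riccatiOp S Q R μ C P = P := h.2.symm
  rw [hr, stateTraj_feedbackInput, feedbackInput, sub_self]
  simp

theorem sum_stageCost_add_stateEnergy_le (hQ : Q.PosDef) (hR : R.PosDef) (hC : C.PosSemidef)
    (h : IsRiccatiSolution S Q R μ C P) (hν : ν ∈ ambiguitySet μ C) (x₀ : Fin n → ℝ) (N : ℕ) :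
    ∑ k ∈ Finset.range N,
        stageCost S Q R x₀ (feedbackInput S (riccatiGain S R μ C P) x₀) ν k +
        stateEnergy S P x₀ (feedbackInput S (riccatiGain S R μ C P) x₀) ν N ≤
      ENNReal.ofReal (x₀ ⬝ᵥ P *ᵥ x₀) := by
  induction N with
  | zero => simp [stateEnergy_zero]
  | succ N ih =>
    rw [Finset.sum_range_succ, add_assoc]
    exact (add_le_add_right (stageCost_add_stateEnergy_le hQ hR hC h hν x₀ N) _).trans ih

theorem expectedCost_feedbackInput_le (hQ : Q.PosDef) (hR : R.PosDef) (hC : C.PosSemidef)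
    (h : IsRiccatiSolution S Q R μ C P) (hν : ν ∈ ambiguitySet μ C) (x₀ : Fin n → ℝ) :
    expectedCost S Q R x₀ (feedbackInput S (riccatiGain S R μ C P) x₀) ν ≤
      ENNReal.ofReal (x₀ ⬝ᵥ P *ᵥ x₀) := by
  rw [expectedCost_eq_tsum x₀ (admissible_feedbackInput S _ x₀), ENNReal.tsum_eq_iSup_nat]
  exact iSup_le fun N =>
    le_self_add.trans (sum_stageCost_add_stateEnergy_le hQ hR hC h hν x₀ N)

/-! ### Vanishing energy along trajectories of finite cost -/

/-- As `Q ≻ 0`, the energy is at most a multiple of the stage cost, the general term of a convergent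
series. It is used with `X = P` for the lower bound and `X = 1` for stability. -/
theorem tendsto_stateEnergy (hQ : Q.PosDef) (hR : R.PosDef) (hu : Admissible u)
    {X : Matrix (Fin n) (Fin n) ℝ} (hX : Xᵀ = X) (x₀ : Fin n → ℝ)
    (hfin : expectedCost S Q R x₀ u ν ≠ ∞) :
    Tendsto (stateEnergy S X x₀ u ν) atTop (𝓝 0) := by
  obtain ⟨c, hc, hle⟩ := exists_le_smul_of_posDef hQ hX
  rw [expectedCost_eq_tsum x₀ hu] at hfin
  have h0 := ENNReal.tendsto_atTop_zero_of_tsum_ne_top hfin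
  have h1 : Tendsto (fun k => ENNReal.ofReal c * stageCost S Q R x₀ u ν k) atTop (𝓝 0) := by
    simpa using ENNReal.Tendsto.const_mul h0 (.inr ENNReal.ofReal_ne_top)
  refine tendsto_of_tendsto_of_tendsto_of_le_of_le tendsto_const_nhds h1 (fun _ => zero_le) ?_
  intro k
  change _ ≤ ENNReal.ofReal c * stageCost S Q R x₀ u ν k
  rw [stateEnergy, stageCost, ← lintegral_const_mul _ (measurable_stage S Q R x₀ hu k)]
  refine lintegral_mono fun w => ?_
  rw [← ENNReal.ofReal_mul hc.le]
  refine ENNReal.ofReal_le_ofReal ?_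
  refine (quad_le_quad hle _).trans ?_
  rw [smul_mulVec, dotProduct_smul, smul_eq_mul]
  exact mul_le_mul_of_nonneg_left
    (le_add_of_nonneg_right (PosSemidef.quad_nonneg hR.posSemidef _)) hc.le

theorem meanSquareStabilizing_of_expectedCost_ne_top (hQ : Q.PosDef) (hR : R.PosDef)
    {K : Matrix (Fin p) (Fin n) ℝ}
    (h : ∀ x₀, expectedCost S Q R x₀ (feedbackInput S K x₀) ν ≠ ∞) :
    MeanSquareStabilizing S ν K := by
  intro x₀
  have := tendsto_stateEnergy hQ hR (admissible_feedbackInput S K x₀) (X := 1) transpose_one x₀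
    (h x₀)
  unfold stateEnergy at this
  simpa only [stateTraj_feedbackInput, one_mulVec] using this

/-! ### The lower bound -/

/-- The expected excess cost `E[(u_k - K x_k)ᵀ D (u_k - K x_k)]`. -/
def excessCost (S : NoisySystem n p m) (D : Matrix (Fin p) (Fin p) ℝ)
    (K : Matrix (Fin p) (Fin n) ℝ) (x₀ : Fin n → ℝ)
    (u : ℕ → (ℕ → Fin m → ℝ) → Fin p → ℝ) (ν : ProbabilityMeasure (Fin m → ℝ)) (k : ℕ) : ℝ≥0∞ :=
  ∫⁻ w, ENNReal.ofReal ((u k w - K *ᵥ stateTraj S x₀ u w k) ⬝ᵥ D *ᵥ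
    (u k w - K *ᵥ stateTraj S x₀ u w k)) ∂(iidLaw ν)

/-- With the nominal moments the Bellman inequality is an identity. It is stated additively because
the terms live in `[0, ∞]` and may be infinite. -/
theorem stateEnergy_add_excessCost (hQ : Q.PosDef) (hR : R.PosDef) (hC : C.PosSemidef)
    (h : IsRiccatiSolution S Q R μ C P) (hν : SquareIntegrable ν)
    (hνC : secondMoment ν = augmentedMoment μ C) (x₀ : Fin n → ℝ) (hu : Admissible u) (k : ℕ) :
    stateEnergy S P x₀ u ν k +
        excessCost S (R + opG S μ C P) (riccatiGain S R μ C P) x₀ u ν k =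
      stageCost S Q R x₀ u ν k + stateEnergy S P x₀ u ν (k + 1) := by
  have hmeas : Measurable fun w =>
      ENNReal.ofReal (stateTraj S x₀ u w k ⬝ᵥ P *ᵥ stateTraj S x₀ u w k) :=
    (measurable_ofReal_quad P).comp (measurable_stateTraj S x₀ hu k)
  rw [stageCost_add_stateEnergy hν hQ hR h.1 (secondMoment_posSemidef hν) x₀ hu, hνC,
    stateEnergy, excessCost, ← lintegral_add_left hmeas]
  refine lintegral_congr fun w => ?_
  have hr : riccatiOp S Q R μ C P = P := h.2.symm
  rw [quad_completion hR hC h.1, hr]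
  exact (ENNReal.ofReal_add (PosSemidef.quad_nonneg h.1 _)
    (PosSemidef.quad_nonneg (posDef_add_opG hR hC h.1).posSemidef _)).symm

/-- Only the excess at time `0` is retained, where the state is deterministic; this suffices to
distinguish gains. -/
theorem add_excessCost_le_sum (hQ : Q.PosDef) (hR : R.PosDef) (hC : C.PosSemidef)
    (h : IsRiccatiSolution S Q R μ C P) (hν : SquareIntegrable ν)
    (hνC : secondMoment ν = augmentedMoment μ C) (x₀ : Fin n → ℝ) (hu : Admissible u) (N : ℕ) :
    ENNReal.ofReal (x₀ ⬝ᵥ P *ᵥ x₀) +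
        excessCost S (R + opG S μ C P) (riccatiGain S R μ C P) x₀ u ν 0 ≤
      ∑ k ∈ Finset.range (N + 1), stageCost S Q R x₀ u ν k + stateEnergy S P x₀ u ν (N + 1) := by
  induction N with
  | zero =>
    rw [← stateEnergy_zero (S := S) (u := u) (ν := ν) P x₀,
      stateEnergy_add_excessCost hQ hR hC h hν hνC x₀ hu]
    simp
  | succ N ih =>
    refine ih.trans ?_
    rw [Finset.sum_range_succ _ (N + 1), add_assoc]
    refine add_le_add_right ?_ _
    rw [← stateEnergy_add_excessCost hQ hR hC h hν hνC x₀ hu]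
    exact le_self_add

theorem add_excessCost_le_expectedCost (hQ : Q.PosDef) (hR : R.PosDef) (hC : C.PosSemidef)
    (h : IsRiccatiSolution S Q R μ C P) (hν : SquareIntegrable ν)
    (hνC : secondMoment ν = augmentedMoment μ C) (x₀ : Fin n → ℝ) (hu : Admissible u) :
    ENNReal.ofReal (x₀ ⬝ᵥ P *ᵥ x₀) +
        excessCost S (R + opG S μ C P) (riccatiGain S R μ C P) x₀ u ν 0 ≤
      expectedCost S Q R x₀ u ν := by
  -- Infinite cost is trivial; finite cost removes the terminal energy in the limit.
  rcases eq_or_ne (expectedCost S Q R x₀ u ν) ∞ with htop | hfin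
  · rw [htop]
    exact le_top
  have h1 := (tendsto_stateEnergy hQ hR hu (PosSemidef.transpose_eq h.1) x₀ hfin).comp
    (tendsto_add_atTop_nat 1)
  have h2 := h1.const_add (expectedCost S Q R x₀ u ν)
  rw [add_zero] at h2
  refine ge_of_tendsto' h2 fun N => ?_
  refine (add_excessCost_le_sum hQ hR hC h hν hνC x₀ hu N).trans ?_
  refine add_le_add_left ?_ _
  rw [expectedCost_eq_tsum x₀ hu]
  exact ENNReal.sum_le_tsum _

/-! ### The distributionally robust LQR problem -/

theorem IsRiccatiSolution.add_excessCost_le_worstCaseCost (hQ : Q.PosDef) (hR : R.PosDef)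
    (hC : C.PosSemidef) (h : IsRiccatiSolution S Q R μ C P) (x₀ : Fin n → ℝ)
    (hu : Admissible u) :
    ∃ ν, ENNReal.ofReal (x₀ ⬝ᵥ P *ᵥ x₀) +
        excessCost S (R + opG S μ C P) (riccatiGain S R μ C P) x₀ u ν 0 ≤
      worstCaseCost S Q R (ambiguitySet μ C) x₀ u := by
  obtain ⟨ν, hν, hνC⟩ := exists_mem_ambiguitySet_secondMoment_eq μ hC
  exact ⟨ν, (add_excessCost_le_expectedCost hQ hR hC h hν.1 hνC x₀ hu).trans
    (le_iSup₂ (f := fun ν (_ : ν ∈ ambiguitySet μ C) => expectedCost S Q R x₀ u ν) ν hν)⟩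

theorem IsRiccatiSolution.le_worstCaseCost (hQ : Q.PosDef) (hR : R.PosDef)
    (hC : C.PosSemidef) (h : IsRiccatiSolution S Q R μ C P) (x₀ : Fin n → ℝ)
    (hu : Admissible u) :
    ENNReal.ofReal (x₀ ⬝ᵥ P *ᵥ x₀) ≤ worstCaseCost S Q R (ambiguitySet μ C) x₀ u := by
  obtain ⟨ν, hν⟩ := h.add_excessCost_le_worstCaseCost hQ hR hC x₀ hu
  exact le_self_add.trans hν

theorem IsRiccatiSolution.worstCaseCost_feedbackInput (hQ : Q.PosDef) (hR : R.PosDef)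
    (hC : C.PosSemidef) (h : IsRiccatiSolution S Q R μ C P) (x₀ : Fin n → ℝ) :
    worstCaseCost S Q R (ambiguitySet μ C) x₀ (feedbackInput S (riccatiGain S R μ C P) x₀) =
      ENNReal.ofReal (x₀ ⬝ᵥ P *ᵥ x₀) :=
  le_antisymm (iSup₂_le fun _ hν => expectedCost_feedbackInput_le hQ hR hC h hν x₀)
    (h.le_worstCaseCost hQ hR hC x₀ (admissible_feedbackInput S _ x₀))

theorem IsRiccatiSolution.isOptimalGain_iff (hQ : Q.PosDef) (hR : R.PosDef)
    (hC : C.PosSemidef) (h : IsRiccatiSolution S Q R μ C P) (K : Matrix (Fin p) (Fin n) ℝ) :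
    IsOptimalGain S Q R (ambiguitySet μ C) K ↔ K = riccatiGain S R μ C P := by
  constructor
  · intro hK
    -- Starting from `e_j`, optimality forces zero excess at time `0`, and definiteness of `R +
    -- G(P)` identifies column `j`.
    refine Matrix.ext_of_mulVec_single fun j => ?_
    set x₀ : Fin n → ℝ := Pi.single j 1
    have hle := (hK x₀).2 _ (admissible_feedbackInput S (riccatiGain S R μ C P) x₀)
    rw [h.worstCaseCost_feedbackInput hQ hR hC] at hle
    obtain ⟨ν, hν⟩ := h.add_excessCost_le_worstCaseCost hQ hR hC x₀ (hK x₀).1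
    have h0 : excessCost S (R + opG S μ C P) (riccatiGain S R μ C P) x₀
        (feedbackInput S K x₀) ν 0 = 0 := by
      refine le_antisymm ?_ zero_le
      refine (ENNReal.add_le_add_iff_left (ENNReal.ofReal_ne_top
        (r := x₀ ⬝ᵥ P *ᵥ x₀))).1 ?_
      rw [add_zero]
      exact hν.trans hle
    simp only [excessCost, stateTraj, feedbackInput, closedLoop, lintegral_const, measure_univ,
      mul_one, ENNReal.ofReal_eq_zero] at h0
    by_contra hne
    exact h0.not_gt (PosDef.quad_pos (posDef_add_opG hR hC h.1) (sub_ne_zero.2 hne))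
  · rintro rfl x₀
    refine ⟨admissible_feedbackInput S _ x₀, fun u hu => ?_⟩
    rw [h.worstCaseCost_feedbackInput hQ hR hC]
    exact h.le_worstCaseCost hQ hR hC x₀ hu

theorem IsRiccatiSolution.meanSquareStabilizing (hQ : Q.PosDef) (hR : R.PosDef)
    (hC : C.PosSemidef) (h : IsRiccatiSolution S Q R μ C P) (hν : ν ∈ ambiguitySet μ C) :
    MeanSquareStabilizing S ν (riccatiGain S R μ C P) :=
  meanSquareStabilizing_of_expectedCost_ne_top hQ hR fun x₀ =>
    ne_top_of_le_ne_top ENNReal.ofReal_ne_top (expectedCost_feedbackInput_le hQ hR hC h hν x₀)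

theorem DRStabilizable.exists_isRiccatiSolution (hQ : Q.PosDef) (hR : R.PosDef)
    (hC : C.PosSemidef) (h : DRStabilizable S (ambiguitySet μ C)) :
    ∃ P, IsRiccatiSolution S Q R μ C P := by
  obtain ⟨K, W, hW, hWL⟩ := exists_lyapunov_certificate hC h
  exact exists_riccatiSolution hQ hR hC hW hWL

end Cost

end DRLQR

end

theorem mainTheorem3 {n p m : ℕ} (S : DRLQR.NoisySystem n p m)
    (Q : Matrix (Fin n) (Fin n) ℝ) (hQ : Q.PosDef)
    (R : Matrix (Fin p) (Fin p) ℝ) (hR : R.PosDef)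
    -- the probability space that carries the data
    {Ω : Type*} [MeasurableSpace Ω] (ℙ : Measure Ω) [IsProbabilityMeasure ℙ]
    -- the true distribution of the disturbance
    (ν₀ : ProbabilityMeasure (Fin m → ℝ)) (hν₀ : DRLQR.SquareIntegrable ν₀)
    -- the random estimate of the covariance
    (Shat : Ω → Matrix (Fin m) (Fin m) ℝ) (hShat_meas : ∀ i j, Measurable fun ω => Shat ω i j)
    (hShat : ∀ ω, (Shat ω).PosSemidef)
    (r : ℝ) (hr : 0 < r) (β : ℝ) (hβ : β ∈ Set.Icc (0 : ℝ) 1)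
    (hconf : 1 - β ≤
      ℙ.real {ω | ν₀ ∈ DRLQR.ambiguitySet (DRLQR.mean ν₀) (r • Shat ω)}) :
    ∃ P : Ω → Matrix (Fin n) (Fin n) ℝ,
      (∀ ω, DRLQR.DRStabilizable S (DRLQR.ambiguitySet (DRLQR.mean ν₀) (r • Shat ω)) →
        (∀ P', DRLQR.IsRiccatiSolution S Q R (DRLQR.mean ν₀) (r • Shat ω) P' ↔ P' = P ω) ∧
        (∀ P', DRLQR.IsSDPSolution S Q R (DRLQR.mean ν₀) (r • Shat ω) P' ↔ P' = P ω) ∧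
        (∀ K, DRLQR.IsOptimalGain S Q R
            (DRLQR.ambiguitySet (DRLQR.mean ν₀) (r • Shat ω)) K ↔
          K = DRLQR.riccatiGain S R (DRLQR.mean ν₀) (r • Shat ω) (P ω)) ∧
        (∀ x₀, DRLQR.worstCaseCost S Q R (DRLQR.ambiguitySet (DRLQR.mean ν₀) (r • Shat ω)) x₀
            (DRLQR.feedbackInput S
              (DRLQR.riccatiGain S R (DRLQR.mean ν₀) (r • Shat ω) (P ω)) x₀) =
          ENNReal.ofReal (x₀ ⬝ᵥ P ω *ᵥ x₀)) ∧
        (∀ ν ∈ DRLQR.ambiguitySet (DRLQR.mean ν₀) (r • Shat ω),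
          DRLQR.MeanSquareStabilizing S ν
            (DRLQR.riccatiGain S R (DRLQR.mean ν₀) (r • Shat ω) (P ω)))) ∧
      1 - β ≤ ℙ.real {ω |
        DRLQR.DRStabilizable S (DRLQR.ambiguitySet (DRLQR.mean ν₀) (r • Shat ω)) →
          DRLQR.MeanSquareStabilizing S ν₀
            (DRLQR.riccatiGain S R (DRLQR.mean ν₀) (r • Shat ω) (P ω))} ∧
      ((∀ᵐ ω ∂ℙ, DRLQR.DRStabilizable S
          (DRLQR.ambiguitySet (DRLQR.mean ν₀) (r • Shat ω))) →
        1 - β ≤ ℙ.real {ω | DRLQR.MeanSquareStabilizing S ν₀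
          (DRLQR.riccatiGain S R (DRLQR.mean ν₀) (r • Shat ω) (P ω))}) := by
  classical
  have hC : ∀ ω, (r • Shat ω).PosSemidef := fun ω => (hShat ω).smul hr.le
  have hex : ∀ ω, ∃ P, DRLQR.DRStabilizable S
      (DRLQR.ambiguitySet (DRLQR.mean ν₀) (r • Shat ω)) →
        DRLQR.IsRiccatiSolution S Q R (DRLQR.mean ν₀) (r • Shat ω) P := by
    intro ω
    by_cases h : DRLQR.DRStabilizable S (DRLQR.ambiguitySet (DRLQR.mean ν₀) (r • Shat ω))
    · obtain ⟨P, hP⟩ := h.exists_isRiccatiSolution hQ hR (hC ω)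
      exact ⟨P, fun _ => hP⟩
    -- Arbitrary value at realizations that are not stabilizable.
    · exact ⟨0, fun h' => absurd h' h⟩
  choose P hP using hex
  have hmain : 1 - β ≤ ℙ.real {ω |
      DRLQR.DRStabilizable S (DRLQR.ambiguitySet (DRLQR.mean ν₀) (r • Shat ω)) →
        DRLQR.MeanSquareStabilizing S ν₀
          (DRLQR.riccatiGain S R (DRLQR.mean ν₀) (r • Shat ω) (P ω))} :=
    -- On the event that `ν₀` is in the ambiguity set, robust stability applies to it. Monotonicity
    -- needs no measurability of the chosen `P`.
    hconf.trans (measureReal_mono fun ω hω h =>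
      (hP ω h).meanSquareStabilizing hQ hR (hC ω) hω)
  refine ⟨P, fun ω h => ⟨(hP ω h).isRiccatiSolution_iff hQ hR (hC ω),
    (hP ω h).isSDPSolution_iff hQ hR (hC ω), (hP ω h).isOptimalGain_iff hQ hR (hC ω),
    (hP ω h).worstCaseCost_feedbackInput hQ hR (hC ω),
    fun ν hν => (hP ω h).meanSquareStabilizing hQ hR (hC ω) hν⟩, hmain, fun hae => ?_⟩
  refine hmain.trans (ENNReal.toReal_mono (measure_ne_top _ _) (measure_mono_ae ?_))
  filter_upwards [hae] with ω h h'
  exact h' h
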